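/- **Definitions.** *Matchings and distances.* A string matching $\tau=(\tau_1,\tau_2):sm\to rm$ is a pair of words of equal length over $\Sigma\cup\{*\}$ such that deleting all $*$ from $\tau_1$ (from $\tau_2$) gives $sm$ (gives $rm$), and for each $i$ either $\tau_1[i]=\tau_2[i]$ or one of them is $*$. Let $sc(\cdot)$ be the number of $*$'s. Put $ED(sm,rm)=\min_\tau\big(sc(\tau_1)+sc(\tau_2)\big)$ and $$SD(sm,rm)=\min_{\tau}\ \max_{1\le i\le|\tau_1|}\frac{sc(\tau_1[i..|\tau_1|])+sc(\tau_2[i..|\tau_2|])}{|\tau_1|-i+1-sc(\tau_1[i..|\tau_1|])}\in[0,\infty]$$ (the maximum over the empty set is $0$, and a zero denominator gives $\infty$). *Edit-distance tree codes.* A prefix code $C:\Sigma_{in}^n\to\Sigma_{out}^n$ is a labelling of the edges of the complete $|\Sigma_{in}|$-ary tree of depth $n$ by symbols of $\Sigma_{out}$; for a word $x$ of length at most $n$, $C(x)$ is the word read on the path from the root to $x$. It is an $\alpha$-edit-distance tree code if there are no nodes $A,B,D,E$ such that $B$ is the lowest common ancestor of $D$ and $E$, $B\ne D$, $B\ne E$,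 $A$ is $B$ or an ancestor of $B$, and $ED(AD,BE)\le\alpha\max(|AD|,|BE|)$, where $AD$ and $BE$ are the words read along the tree paths. *Pointer jumping $PJP(T)$.* In the complete binary tree of depth $T$, Alice's input $X$ contains exactly one edge leaving each non-leaf vertex of even depth, Bob's input $Y$ exactly one edge leaving each non-leaf vertex of odd depth (and no other edges). The task of both is to output the leaf at the end of the unique root-to-leaf path in $X\cup Y$. An edge has level $\ell$ if its lower endpoint has depth $\ell$; its grandparent is the edge two levels above it on the path from the root. *The protocol $\pi$* (parameters $T,N,\rho$, a tree code $C$ of depth $N$ with $\Sigma_{in}=\{0,\dots,N\}\times\{1,2,3,4\}$, and $R=\lfloor(1-2\rho)N\rfloor$). A symbol $(n,s)$ sent by a party announces: the empty edge if $n=N$; an edge on the party's first own level (level 1 for Alice, level 2 for Bob), selected by $s$, if $n=0$; and otherwise the $s$-th grandchild of the edge that this party announced in its round $n$. For a word $d$ of symbols of a party, $E(d)$ is the set of edges announced, or $\emptyset$ if some symbol of $d$ is not valid (there is no such edge in the tree, or round $n$ is not an earlier round in which a nonempty edge was announced). Each party has a counter $s(v)=0$ for each leaf $v$. In its round $i=1,\dots,N$,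 a party with input $Z$ 1. receives a symbol (except Alice in round 1); let $r$ be the word of all symbols it has received so far; 2. finds $d\in\Sigma_{in}^{\le N}$ minimizing $SD(C(d),r)$; 3. if $E(d)\cup Z$ has a unique path from the root (the vertices reachable from the root along its edges are the vertices of one path): it increases $s(v)$ by 1 if the path ends at a leaf $v$; and it lets $e$ be the deepest edge of the path that belongs to $Z$ and that either has level at most 2 or has a grandparent that it has itself announced in an earlier round; it announces $e$, or the empty edge if there is no such $e$; 4. if $E(d)\cup Z$ has no unique path from the root, it announces the empty edge; 5. if $i=R$, outputs a leaf $v$ with the largest $s(v)$; 6. sends the last symbol of $C(s[1..i])$, where $s[1..i]$ is the word of its announcements so far. All choices left open (ties in steps 2 and 5, and which earlier round is cited as $n$) may be made in any fixed way, separately for each party. *The channel.* Alice starts with her round 1. At any time one symbol is in transit. The adversary either lets it be delivered, or makes an edit corruption: it deletes the symbol and inserts an arbitrary symbol, either in the same direction (to the addressee) or in the opposite direction (to the sender of the deleted symbol, as a spoofed reply). The party that receives a symbol carries out its next round and sends a symbol; the execution ends when a symbol reaches a party that has completed its $N$ rounds. **Theorem.** Let $0<\varepsilon\le\frac1{18}$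 and $\rho=\frac1{18}-\varepsilon$. There are constants $c,k$, depending only on $\varepsilon$, such that the following holds for every $T\ge1$, with $N=\lceil\frac{T}{16\varepsilon}\rceil$ and $R=\lfloor(1-2\rho)N\rfloor$. (a) There is a $(1-\varepsilon)$-edit-distance tree code of depth $N$ with input alphabet $\{0,\dots,N\}\times\{1,2,3,4\}$ and an output alphabet of size at most $cT^k$. (b) For every $(1-\varepsilon)$-edit-distance tree code $C$ of depth $N$ with this input alphabet and any output alphabet, the protocol $\pi$ with $C$ solves $PJP(T)$ and is resilient to a $\rho$-fraction of edit corruptions: for all inputs $X,Y$ and every adversary that makes at most $2\rho N$ edit corruptions, the execution ends after at most $2N$ channel events; when it ends, both parties have reached their round $R$; and each party that reaches its round $R$ outputs there the correct leaf. -/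

import Mathlib

open scoped ENNReal

namespace EditPJP

/-! ### String matchings, edit distance, suffix distance -/

/-- A pair of strings of equal length over the alphabet extended by the blank `*`, given as its
list of columns; `none` is the blank. -/
abbrev Columns (Γ : Type) := List (Option Γ × Option Γ)

/-- `τ` is a string matching from the sent word `sm` to the received word `rm`: deleting the blanks
of the first (second) row gives `sm` (`rm`), and in every column the two entries are equal or one
of them is a blank. -/
def IsMatching {Γ : Type} (τ : Columns Γ) (sm rm : List Γ) : Prop :=
  τ.filterMap Prod.fst = sm ∧ τ.filterMap Prod.snd = rm ∧
    ∀ c ∈ τ, c.1 = c.2 ∨ c.1 = none ∨ c.2 = none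

/-- The number of blanks in the first row. -/
def blanks₁ {Γ : Type} (τ : Columns Γ) : ℕ := τ.countP fun c => c.1.isNone

/-- The number of blanks in the second row. -/
def blanks₂ {Γ : Type} (τ : Columns Γ) : ℕ := τ.countP fun c => c.2.isNone

/-- Edit distance: the least total number of blanks in a string matching. -/
noncomputable def editDist {Γ : Type} (sm rm : List Γ) : ℕ :=
  sInf {k | ∃ τ : Columns Γ, IsMatching τ sm rm ∧ k = blanks₁ τ + blanks₂ τ}

/-- Suffix distance: the minimum over all string matchings `τ` of the maximum over all nonempty
suffixes `σ` of `τ` of the number of blanks of `σ` divided by the number of non-blanks in the first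
row of `σ`. The quotient is `∞` if the first row of `σ` has blanks only. -/
noncomputable def suffixDist {Γ : Type} (sm rm : List Γ) : ℝ≥0∞ :=
  ⨅ (τ : Columns Γ) (_ : IsMatching τ sm rm), ⨆ (σ : Columns Γ) (_ : σ ≠ [] ∧ σ <:+ τ),
    ((blanks₁ σ + blanks₂ σ : ℕ) : ℝ≥0∞) / ((σ.length - blanks₁ σ : ℕ) : ℝ≥0∞)

/-! ### Prefix codes as labelled trees -/

/-- A prefix code of depth `n`, seen as a tree: the nodes are the words of length at most `n`, and
`C x` is the symbol on the edge that enters the node `x ≠ []`. Values of `C` at other words are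
never used. -/
abbrev PrefixCode (S Γ : Type) := List S → Γ

/-- The symbols on the path that starts at the node `A` and follows the input symbols in the second
argument. -/
def pathWord {S Γ : Type} (C : PrefixCode S Γ) : List S → List S → List Γ
  | _, [] => []
  | A, a :: w => C (A ++ [a]) :: pathWord C (A ++ [a]) w

/-- The symbols on the tree path from the node `A` down to its descendant `D`. -/
def between {S Γ : Type} (C : PrefixCode S Γ) (A D : List S) : List Γ :=
  pathWord C A (D.drop A.length)

/-- The encoding of the message `x`: the symbols on the path from the root to `x`. -/
def encode {S Γ : Type} (C : PrefixCode S Γ) (x : List S) : List Γ := between C [] x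

/-- An `α`-bad lambda: `A` is an ancestor of `B` or `B` itself, `B` is the (lowest) common ancestor
of `D` and `E` and is different from both, and the words `AD` and `BE` are `α`-close in edit
distance. -/
def HasBadLambda {S Γ : Type} (α : ℝ) (n : ℕ) (C : PrefixCode S Γ) : Prop :=
  ∃ A B D E : List S, A <+: B ∧ B <+: D ∧ B <+: E ∧ B ≠ D ∧ B ≠ E ∧
    (∀ G, G <+: D → G <+: E → G <+: B) ∧ D.length ≤ n ∧ E.length ≤ n ∧
    (editDist (between C A D) (between C B E) : ℝ) ≤
      α * max ((between C A D).length : ℝ) ((between C B E).length : ℝ)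

/-- `α`-edit-distance tree codes of depth `n`. -/
def IsEditTreeCode {S Γ : Type} (α : ℝ) (n : ℕ) (C : PrefixCode S Γ) : Prop :=
  ¬ HasBadLambda α n C

/-! ### The pointer jumping problem -/

/-- The two parties. -/
inductive Party
  | alice
  | bob
  deriving DecidableEq

/-- The other party. -/
def Party.other : Party → Party
  | .alice => .bob
  | .bob => .alice

/-- Alice owns the edges that leave vertices of even depth, Bob the others. -/
def Party.parity : Party → ℕ
  | .alice => 0
  | .bob => 1

/-- Vertices of the binary tree of depth `T` are the words over `Bool` of length at most `T`. An
edge is named by its lower endpoint; it leaves the vertex `e.dropLast` and lies on level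
`e.length`. -/
abbrev Edge := List Bool

/-- `X` is an input of the party `p` for the pointer jumping problem of depth `T`: it consists of
edges leaving vertices of the parity of `p`, exactly one for each such vertex. -/
def IsInput (T : ℕ) (p : Party) (X : Set Edge) : Prop :=
  (∀ e ∈ X, ∃ (v : List Bool) (b : Bool), e = v ++ [b] ∧ v.length < T ∧
    v.length % 2 = p.parity) ∧
  ∀ v : List Bool, v.length < T → v.length % 2 = p.parity → ∃! b : Bool, v ++ [b] ∈ X

/-- All edges on the path from the root to `v` belong to `S`. -/
def IsPathIn (S : Set Edge) (v : List Bool) : Prop := ∀ e : Edge, e ≠ [] → e <+: v → e ∈ S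

/-- The edges in `S` form a unique path from the root, and it ends at `v`: the vertices that can be
reached from the root along `S` are exactly those on the path to `v`. -/
def IsUniquePathIn (S : Set Edge) (v : List Bool) : Prop :=
  IsPathIn S v ∧ ∀ w, IsPathIn S w → w <+: v

/-- `v` is the leaf at the end of the path that the two inputs define. -/
def IsCorrectLeaf (T : ℕ) (X : Party → Set Edge) (v : List Bool) : Prop :=
  v.length = T ∧ IsPathIn (X .alice ∪ X .bob) v

/-! ### The protocol -/

/-- The input alphabet of the tree code: pairs `(n, s)` with `0 ≤ n ≤ N` and four values of `s`. -/
abbrev Sym (N : ℕ) := Fin (N + 1) × Fin 4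

/-- The number (from `0` to `3`) of the grandchild that is reached by the two bits. -/
def ofBits : Bool → Bool → Fin 4
  | false, false => 0
  | false, true => 1
  | true, false => 2
  | true, true => 3

/-- The first of the two bits. -/
def bit₁ (s : Fin 4) : Bool := decide (2 ≤ s.val)

/-- The second of the two bits. -/
def bit₂ (s : Fin 4) : Bool := decide (s.val % 2 = 1)

/-- The value `s` that tells which grandchild of its grandparent the edge is; the edges on the first
level are numbered `0` and `1`. -/
def grandIndex (e : Edge) : Fin 4 :=
  match e.reverse with
  | [] => 0
  | [b] => ofBits false b
  | b₂ :: b₁ :: _ => ofBits b₁ b₂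

/-- The grandparent of an edge. -/
def grandparent (e : Edge) : Edge := e.take (e.length - 2)

/-- The announcement meant by the symbol `(n, s)` of the party `p`, where `acc` lists what the
earlier symbols announced (`none` is the empty edge): `n = N` means the empty edge, `n = 0` an edge
on the first level (Alice) or the second level (Bob), and any other `n` the `s`-th grandchild of the
edge sent in round `n`. The result is `none` if the symbol is not valid. -/
def decodeSym (T N : ℕ) (p : Party) (acc : List (Option Edge)) (σ : Sym N) :
    Option (Option Edge) :=
  let valid (e : Edge) : Option (Option Edge) := if e.length ≤ T then some (some e) else none
  if σ.1.val = N then some none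
  else if σ.1.val = 0 then
    match p with
    | .alice => if bit₁ σ.2 then none else valid [bit₂ σ.2]
    | .bob => valid [bit₁ σ.2, bit₂ σ.2]
  else
    match acc[σ.1.val - 1]? with
    | some (some e) => valid (e ++ [bit₁ σ.2, bit₂ σ.2])
    | _ => none

/-- The list of announcements meant by a word of symbols of the party `p`; `none` if the word is not
valid. -/
def decodeWord (T N : ℕ) (p : Party) (d : List (Sym N)) : Option (List (Option Edge)) :=
  d.foldlM (fun acc σ => (decodeSym T N p acc σ).map fun e => acc ++ [e]) []

/-- The set `E(d)` of edges indicated by a word `d` of symbols of the party `p`; it is empty if `d`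
is not valid. -/
def edgeSet (T N : ℕ) (p : Party) (d : List (Sym N)) : Set Edge :=
  {e | ∃ l, decodeWord T N p d = some l ∧ some e ∈ l}

/-- A resolution of the choices that the protocol leaves open: `dec` picks a message of suffix
distance minimal to the received word, `ref` picks a round in which a given edge was announced
(rounds are numbered from `1`), and `pick` picks a leaf with the largest counter. -/
structure Choices {Γ : Type} (T N : ℕ) (C : PrefixCode (Sym N) Γ) where
  dec : List Γ → List (Sym N)
  dec_length : ∀ r, (dec r).length ≤ N
  dec_min : ∀ (r : List Γ) (m : List (Sym N)), m.length ≤ N →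
    suffixDist (encode C (dec r)) r ≤ suffixDist (encode C m) r
  ref : List (Option Edge) → Edge → ℕ
  ref_spec : ∀ (l : List (Option Edge)) (e : Edge), some e ∈ l →
    1 ≤ ref l e ∧ l[ref l e - 1]? = some (some e)
  pick : (List Bool → ℕ) → List Bool
  pick_length : ∀ s, (pick s).length = T
  pick_max : ∀ (s : List Bool → ℕ) (v : List Bool), v.length = T → s v ≤ s (pick s)

/-- The symbol by which an edge (or the empty edge) is announced, where `l` lists the earlier
announcements of the same party. -/
def symbolOf {Γ : Type} {T N : ℕ} {C : PrefixCode (Sym N) Γ} (ch : Choices T N C)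
    (l : List (Option Edge)) : Option Edge → Sym N
  | none => (Fin.last N, 0)
  | some e =>
      (Fin.ofNat (N + 1) (if e.length ≤ 2 then 0 else ch.ref l (grandparent e)), grandIndex e)

/-- The local state of a party: the symbols received, the symbols of the input alphabet and the
announcements sent, one per round, the counters of the leaves, and the output, once it is made. -/
structure PartyState (N : ℕ) (Γ : Type) where
  recv : List Γ := []
  sent : List (Sym N) := []
  announced : List (Option Edge) := []
  votes : List Bool → ℕ := fun _ => 0
  output : Option (List Bool) := none

/-- The counter `i` of the party: the number of rounds it has carried out. -/
def PartyState.rounds {N : ℕ} {Γ : Type} (st : PartyState N Γ) : ℕ := st.sent.length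

/-- The party with input `X` may announce `e`: the edge is its own, and it lies on the first two
levels or its grandparent has been announced before. -/
def MayAnnounce (X : Set Edge) (announced : List (Option Edge)) (e : Edge) : Prop :=
  e ≠ [] ∧ e ∈ X ∧ (e.length ≤ 2 ∨ some (grandparent e) ∈ announced)

open Classical in
/-- The end of the unique path from the root in `S`, if there is one. -/
noncomputable def uniquePath (S : Set Edge) : Option (List Bool) :=
  if h : ∃ v, IsUniquePathIn S v then some h.choose else none

open Classical in
/-- The deepest edge on the path to `v` that may be announced, if there is one. -/
noncomputable def nextEdge (X : Set Edge) (announced : List (Option Edge)) (v : List Bool) :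
    Option Edge :=
  v.inits.reverse.find? fun e => decide (MayAnnounce X announced e)

/-- One round of the party `p` with input `X`, after the received symbol (if any) has been appended
to `st.recv`. The output is made in round `R`. -/
noncomputable def round {Γ : Type} {T N : ℕ} {C : PrefixCode (Sym N) Γ} (ch : Choices T N C)
    (R : ℕ) (p : Party) (X : Set Edge) (st : PartyState N Γ) : PartyState N Γ :=
  let path := uniquePath (edgeSet T N p.other (ch.dec st.recv) ∪ X)
  let votes : List Bool → ℕ := fun v =>
    if v.length = T ∧ path = some v then st.votes v + 1 else st.votes v
  let e : Option Edge := path.bind (nextEdge X st.announced)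
  { recv := st.recv
    sent := st.sent ++ [symbolOf ch st.announced e]
    announced := st.announced ++ [e]
    votes := votes
    output := if st.rounds + 1 = R then some (ch.pick votes) else st.output }

/-! ### The channel with edit corruptions -/

/-- What happens to the symbol in transit: it is delivered; or it is deleted and a symbol is inserted
in the same direction; or it is deleted and a symbol is inserted in the opposite direction, which its
sender receives as a reply. -/
inductive Event (Γ : Type)
  | deliver
  | substitute (σ : Γ)
  | outOfSync (σ : Γ)

/-- Whether the event is an edit corruption. -/
def Event.isCorruption {Γ : Type} : Event Γ → Bool
  | .deliver => false
  | .substitute _ => true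
  | .outOfSync _ => true

/-- The number of edit corruptions. -/
def corruptions {Γ : Type} (events : List (Event Γ)) : ℕ := events.countP Event.isCorruption

/-- The state of the whole system: the two local states and the sender of the symbol in transit.
If there is none, the execution has ended. -/
structure State (N : ℕ) (Γ : Type) where
  party : Party → PartyState N Γ
  sender : Option Party

/-- The party `p` receives the symbol `σ`. It carries out its next round and sends a symbol, unless
it has completed its `N` rounds. -/
noncomputable def receive {Γ : Type} {T N : ℕ} {C : PrefixCode (Sym N) Γ}
    (ch : Party → Choices T N C) (R : ℕ) (X : Party → Set Edge) (st : State N Γ) (p : Party)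
    (σ : Γ) : State N Γ :=
  let loc := st.party p
  if loc.rounds < N then
    { party := Function.update st.party p
        (round (ch p) R p (X p) { loc with recv := loc.recv ++ [σ] })
      sender := some p }
  else { st with sender := none }

/-- One event. The symbol in transit is the label of the last edge of the path of all the symbols
sent so far by its sender. -/
noncomputable def step {Γ : Type} {T N : ℕ} {C : PrefixCode (Sym N) Γ}
    (ch : Party → Choices T N C) (R : ℕ) (X : Party → Set Edge) (st : State N Γ) (ev : Event Γ) :
    State N Γ :=
  match st.sender with
  | none => st
  | some p =>
    match ev with
    | .deliver => receive ch R X st p.other (C (st.party p).sent)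
    | .substitute σ => receive ch R X st p.other σ
    | .outOfSync σ => receive ch R X st p σ

/-- At the start Alice carries out her first round without receiving a symbol. -/
noncomputable def initial {Γ : Type} {T N : ℕ} {C : PrefixCode (Sym N) Γ}
    (ch : Party → Choices T N C) (R : ℕ) (X : Party → Set Edge) : State N Γ where
  party := Function.update (fun _ => {}) .alice (round (ch .alice) R .alice (X .alice) {})
  sender := some .alice

/-- The state after the given sequence of events. -/
noncomputable def run {Γ : Type} {T N : ℕ} {C : PrefixCode (Sym N) Γ}
    (ch : Party → Choices T N C) (R : ℕ) (X : Party → Set Edge) (events : List (Event Γ)) :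
    State N Γ :=
  events.foldl (step ch R X) (initial ch R X)

/-- The choices of the protocol can be made: all the minima and maxima are attained. -/
instance {Γ : Type} (T N : ℕ) (C : PrefixCode (Sym N) Γ) : Nonempty (Choices T N C) := by
  have h1 : ∀ r : List Γ, ∃ d : List (Sym N), d.length ≤ N ∧ ∀ m : List (Sym N), m.length ≤ N →
      suffixDist (encode C d) r ≤ suffixDist (encode C m) r := by
    intro r
    obtain ⟨d, hd, h⟩ := (List.finite_length_le (Sym N) N).exists_minimalFor
      (fun m => suffixDist (encode C m) r) _ ⟨[], by simp⟩
    refine ⟨d, hd, fun m hm => ?_⟩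
    rcases le_total (suffixDist (encode C d) r) (suffixDist (encode C m) r) with h' | h'
    · exact h'
    · exact h hm h'
  have h2 : ∀ (l : List (Option Edge)) (e : Edge), ∃ n : ℕ, some e ∈ l →
      1 ≤ n ∧ l[n - 1]? = some (some e) := by
    intro l e
    by_cases h : some e ∈ l
    · obtain ⟨n, hn⟩ := List.mem_iff_getElem?.1 h
      exact ⟨n + 1, fun _ => ⟨by omega, by simpa using hn⟩⟩
    · exact ⟨0, fun h' => absurd h' h⟩
  have h3 : ∀ s : List Bool → ℕ, ∃ v : List Bool, v.length = T ∧
      ∀ w : List Bool, w.length = T → s w ≤ s v := by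
    intro s
    obtain ⟨v, hv, h⟩ := (List.finite_length_eq Bool T).exists_maximalFor s _
      ⟨List.replicate T false, by simp⟩
    refine ⟨v, hv, fun w hw => ?_⟩
    rcases le_total (s w) (s v) with h' | h'
    · exact h'
    · exact h hw h'
  choose dec hd1 hd2 using h1
  choose ref hr using h2
  choose pick hp1 hp2 using h3
  exact ⟨⟨dec, hd1, hd2, ref, hr, pick, hp1, hp2⟩⟩

end EditPJP

namespace EditPJP

/-! ### Matchings and common subsequences -/

section Matchings

variable {Γ : Type}

/-! Existence of the code: an edge is labelled by its depth and by a Toeplitz hash of the word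
leading to it, over a prime field. Because the depth is visible, a common subsequence of two paths
can only pair symbols of equal depth, so edit distance reduces to Hamming distance
(`isEditTreeCode_of_hamming`). A union bound supplies a Toeplitz hash under which diverging paths
agree in at most half of their places (`exists_toeplitz`).

Decoding: if two messages fit the same received word so that in each suffix the blanks number at
most (1 - 2ε)/2 times the sent symbols, a bad lambda appears where the messages part
(`eq_of_suffixBound`). So a party decodes wrongly only when the true matching has a suffix that is
too rich in blanks. An amortization over such suffixes (`badCount_le`) bounds the wrong decodings.
Up to the factor 1/β, with β close to 1, a substitution accounts for 4 wrong decodings of its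
receiver, and a spoofed reply for 3 of the party that gets it and 1 of the other.

Votes: a wrong decoding costs the correct leaf at most two votes of margin, one given to another
leaf and one missed. A correct decoding is idle, that is, comes too early for a vote, only while the
other party's announcements do not yet reach the leaf. An idle round either advances the party's own
announcements or is followed by an advance of the other party, by a wrong decoding there, or by a
spoofed reply. Hence idle ≤ T/2 + (wrong decodings of the other party) + (spoofed replies), see
`Healthy.exists_round` and `idle_le`.

Balance: with K corruptions, β times 2·bad + bad₂ + oos is at most 8K ≤ 16ρN (`Accounting.bad_le`).
The correct leaf wins if this, with T/2 added, stays below R ≈ (1 - 2ρ)N; the threshold 16ρ = 1 - 2ρ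
is ρ = 1/18. The round counters drift apart only through spoofed replies, at most 2ρN of them, so
both parties get as far as round R. -/

theorem isMatching_nil : IsMatching ([] : Columns Γ) [] [] := by simp [IsMatching]

theorem IsMatching.append {σ τ : Columns Γ} {s₁ s₂ r₁ r₂ : List Γ} (hσ : IsMatching σ s₁ r₁)
    (hτ : IsMatching τ s₂ r₂) : IsMatching (σ ++ τ) (s₁ ++ s₂) (r₁ ++ r₂) := by
  refine ⟨by rw [List.filterMap_append, hσ.1, hτ.1], by rw [List.filterMap_append, hσ.2.1, hτ.2.1],
    fun c hc => ?_⟩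
  rcases List.mem_append.1 hc with h | h
  · exact hσ.2.2 c h
  · exact hτ.2.2 c h

theorem isMatching_cons_iff {c : Option Γ × Option Γ} {τ : Columns Γ} {s r : List Γ} :
    IsMatching (c :: τ) s r ↔ (c.1 = c.2 ∨ c.1 = none ∨ c.2 = none) ∧
      ∃ s' r', s = c.1.toList ++ s' ∧ r = c.2.toList ++ r' ∧ IsMatching τ s' r' := by
  obtain ⟨a, b⟩ := c
  constructor
  · rintro ⟨h1, h2, h3⟩
    refine ⟨h3 _ List.mem_cons_self, τ.filterMap Prod.fst, τ.filterMap Prod.snd, ?_, ?_, rfl, rfl,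
      fun c hc => h3 c (List.mem_cons_of_mem _ hc)⟩
    · rw [← h1]; cases a <;> simp
    · rw [← h2]; cases b <;> simp
  · rintro ⟨h, s', r', rfl, rfl, h1, h2, h3⟩
    refine ⟨?_, ?_, ?_⟩
    · cases a <;> simp [h1]
    · cases b <;> simp [h2]
    · intro c hc
      rcases List.mem_cons.1 hc with rfl | hc
      · exact h
      · exact h3 c hc

@[simp] theorem blanks₁_nil : blanks₁ ([] : Columns Γ) = 0 := rfl

@[simp] theorem blanks₂_nil : blanks₂ ([] : Columns Γ) = 0 := rfl

@[simp] theorem blanks₁_append (σ τ : Columns Γ) :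
    blanks₁ (σ ++ τ) = blanks₁ σ + blanks₁ τ := List.countP_append

@[simp] theorem blanks₂_append (σ τ : Columns Γ) :
    blanks₂ (σ ++ τ) = blanks₂ σ + blanks₂ τ := List.countP_append

theorem blanks₁_cons (c : Option Γ × Option Γ) (τ : Columns Γ) :
    blanks₁ (c :: τ) = blanks₁ τ + if c.1.isNone then 1 else 0 := List.countP_cons

theorem blanks₂_cons (c : Option Γ × Option Γ) (τ : Columns Γ) :
    blanks₂ (c :: τ) = blanks₂ τ + if c.2.isNone then 1 else 0 := List.countP_cons

theorem IsMatching.length_fst {τ : Columns Γ} {s r : List Γ} (h : IsMatching τ s r) :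
    s.length + blanks₁ τ = τ.length := by
  induction τ generalizing s r with
  | nil => simp [← h.1]
  | cons c τ ih =>
    obtain ⟨_, s', r', rfl, rfl, h'⟩ := isMatching_cons_iff.1 h
    have := ih h'
    rw [blanks₁_cons]
    obtain ⟨_ | a, b⟩ := c <;> simp <;> omega

theorem IsMatching.length_snd {τ : Columns Γ} {s r : List Γ} (h : IsMatching τ s r) :
    r.length + blanks₂ τ = τ.length := by
  induction τ generalizing s r with
  | nil => simp [← h.2.1]
  | cons c τ ih =>
    obtain ⟨_, s', r', rfl, rfl, h'⟩ := isMatching_cons_iff.1 h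
    have := ih h'
    rw [blanks₂_cons]
    obtain ⟨a, _ | b⟩ := c <;> simp <;> omega

/-- The matched pairs of a string matching form a common subsequence. -/
theorem IsMatching.exists_sublist {τ : Columns Γ} {s r : List Γ} (h : IsMatching τ s r) :
    ∃ w : List Γ, w.Sublist s ∧ w.Sublist r ∧ s.length + r.length ≤ blanks₁ τ + blanks₂ τ + 2 * w.length := by
  induction τ generalizing s r with
  | nil => exact ⟨[], by simp, by simp, by simp [← h.1, ← h.2.1]⟩
  | cons c τ ih =>
    obtain ⟨hc, s', r', rfl, rfl, h'⟩ := isMatching_cons_iff.1 h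
    obtain ⟨w, hs, hr, hl⟩ := ih h'
    rw [blanks₁_cons, blanks₂_cons]
    obtain ⟨_ | a, _ | b⟩ := c
    · exact ⟨w, by simpa, by simpa, by simp; omega⟩
    · exact ⟨w, by simpa, by simpa using hr.cons b, by simp; omega⟩
    · exact ⟨w, by simpa using hs.cons a, by simpa, by simp; omega⟩
    · obtain rfl : a = b := by simpa using hc
      exact ⟨a :: w, by simpa, by simpa, by simp; omega⟩

/-- Converse of `IsMatching.exists_sublist`: the symbols of `w` become full columns and every other
symbol is set against a blank. -/
theorem exists_isMatching_of_sublist {s r w : List Γ} (hs : w.Sublist s) (hr : w.Sublist r) :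
    ∃ τ : Columns Γ, IsMatching τ s r ∧
      blanks₁ τ + blanks₂ τ + 2 * w.length = s.length + r.length := by
  induction hs generalizing r with
  | slnil =>
    refine ⟨r.map fun b => (none, some b), ⟨?_, ?_, ?_⟩, ?_⟩
    · induction r <;> simp_all
    · induction r <;> simp_all
    · simp
    · simp [blanks₁, blanks₂, List.countP_map, Function.comp_def]
  | @cons w s a _ ih =>
    obtain ⟨τ, h, hl⟩ := ih hr
    refine ⟨(some a, none) :: τ, isMatching_cons_iff.2 ⟨by simp, _, _, rfl, rfl, h⟩, ?_⟩
    simp [blanks₁_cons, blanks₂_cons]; omega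
  | @cons_cons w s a _ ih =>
    obtain ⟨r₁, r₂, rfl, h₁, h₂⟩ := List.append_sublist_iff.1 (show ([a] ++ w).Sublist r from hr)
    obtain ⟨p, t, rfl⟩ := List.append_of_mem (List.singleton_sublist.1 h₁)
    obtain ⟨τ, h, hl⟩ := ih (h₂.trans (List.sublist_append_right t r₂))
    refine ⟨(p.map fun b => (none, some b)) ++ (some a, some a) :: τ, ?_, ?_⟩
    · have h0 : IsMatching ((p.map fun b => (none, some b)) : Columns Γ) [] p := by
        refine ⟨?_, ?_, by simp⟩ <;> induction p <;> simp_all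
      have := h0.append (isMatching_cons_iff (c := (some a, some a)).2 ⟨Or.inl rfl, _, _, rfl, rfl, h⟩)
      simpa using this
    · have e1 : blanks₁ ((p.map fun b => (none, some b)) : Columns Γ) = p.length := by
        simp [blanks₁, List.countP_map, Function.comp_def]
      have e2 : blanks₂ ((p.map fun b => (none, some b)) : Columns Γ) = 0 := by
        simp [blanks₂, List.countP_map, Function.comp_def]
      simp only [blanks₁_append, blanks₂_append, blanks₁_cons, blanks₂_cons, e1, e2]
      simp at hl ⊢; omega

/-- The edit distance is governed by the longest common subsequence. -/
theorem editDist_le_iff {s r : List Γ} {k : ℕ} : editDist s r ≤ k ↔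
    ∃ w : List Γ, w.Sublist s ∧ w.Sublist r ∧ s.length + r.length ≤ k + 2 * w.length := by
  constructor
  · intro h
    have hne : {k | ∃ τ : Columns Γ, IsMatching τ s r ∧ k = blanks₁ τ + blanks₂ τ}.Nonempty := by
      obtain ⟨τ, hτ, _⟩ := exists_isMatching_of_sublist (List.nil_sublist s) (List.nil_sublist r)
      exact ⟨_, τ, hτ, rfl⟩
    obtain ⟨τ, hτ, hk⟩ := Nat.sInf_mem hne
    obtain ⟨w, h1, h2, h3⟩ := hτ.exists_sublist
    refine ⟨w, h1, h2, ?_⟩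
    unfold editDist at h
    omega
  · rintro ⟨w, h1, h2, h3⟩
    obtain ⟨τ, hτ, hl⟩ := exists_isMatching_of_sublist h1 h2
    have hle : editDist s r ≤ blanks₁ τ + blanks₂ τ := Nat.sInf_le ⟨τ, hτ, rfl⟩
    omega

/-- Two subsequences of `r` occupy two sets of positions, and these meet in at least `w.length +
w'.length - r.length` places. -/
theorem exists_common_sublist {w w' r : List Γ} (h : w.Sublist r) (h' : w'.Sublist r) :
    ∃ t : List Γ, t.Sublist w ∧ t.Sublist w' ∧ w.length + w'.length ≤ r.length + t.length := by
  induction r generalizing w w' with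
  | nil =>
    obtain rfl := List.sublist_nil.1 h
    obtain rfl := List.sublist_nil.1 h'
    exact ⟨[], by simp⟩
  | cons a r ih =>
    rcases List.sublist_cons_iff.1 h with h1 | ⟨v, rfl, h1⟩ <;>
      rcases List.sublist_cons_iff.1 h' with h2 | ⟨v', rfl, h2⟩ <;>
      obtain ⟨t, t1, t2, t3⟩ := ih h1 h2
    · exact ⟨t, t1, t2, by simp; omega⟩
    · exact ⟨t, t1, t2.cons a, by simp; omega⟩
    · exact ⟨t, t1.cons a, t2, by simp; omega⟩
    · exact ⟨a :: t, t1.cons_cons a, t2.cons_cons a, by simp; omega⟩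

/-- The triangle inequality, for string matchings to the same word. -/
theorem editDist_le_of_isMatching {σ τ : Columns Γ} {s s' r : List Γ} (hσ : IsMatching σ s r)
    (hτ : IsMatching τ s' r) :
    editDist s s' ≤ blanks₁ σ + blanks₂ σ + (blanks₁ τ + blanks₂ τ) := by
  obtain ⟨w, h1, h2, h3⟩ := hσ.exists_sublist
  obtain ⟨w', h1', h2', h3'⟩ := hτ.exists_sublist
  obtain ⟨t, t1, t2, t3⟩ := exists_common_sublist h2 h2'
  exact editDist_le_iff.2 ⟨t, t1.trans h1, t2.trans h1', by omega⟩

theorem editDist_append_le (s r t : List Γ) : editDist (s ++ t) r ≤ editDist s r + t.length := by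
  obtain ⟨w, h1, h2, h3⟩ := editDist_le_iff.1 (le_refl (editDist s r))
  exact editDist_le_iff.2 ⟨w, h1.trans (List.sublist_append_left s t), h2, by simp; omega⟩

theorem IsMatching.split_fst {τ : Columns Γ} {s₁ s₂ r : List Γ} (h : IsMatching τ (s₁ ++ s₂) r) :
    ∃ τ₁ τ₂ r₁ r₂, τ = τ₁ ++ τ₂ ∧ r = r₁ ++ r₂ ∧ IsMatching τ₁ s₁ r₁ ∧ IsMatching τ₂ s₂ r₂ := by
  obtain ⟨h1, h2, h3⟩ := h
  obtain ⟨τ₁, τ₂, rfl, e1, e2⟩ := List.filterMap_eq_append_iff.1 h1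
  exact ⟨τ₁, τ₂, _, _, rfl, by rw [← h2, List.filterMap_append],
    ⟨e1, rfl, fun c hc => h3 c (by simp [hc])⟩, ⟨e2, rfl, fun c hc => h3 c (by simp [hc])⟩⟩

theorem IsMatching.split_snd {τ : Columns Γ} {s r₁ r₂ : List Γ} (h : IsMatching τ s (r₁ ++ r₂)) :
    ∃ τ₁ τ₂ s₁ s₂, τ = τ₁ ++ τ₂ ∧ s = s₁ ++ s₂ ∧ IsMatching τ₁ s₁ r₁ ∧ IsMatching τ₂ s₂ r₂ := by
  obtain ⟨h1, h2, h3⟩ := h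
  obtain ⟨τ₁, τ₂, rfl, e1, e2⟩ := List.filterMap_eq_append_iff.1 h2
  exact ⟨τ₁, τ₂, _, _, rfl, by rw [← h1, List.filterMap_append],
    ⟨rfl, e1, fun c hc => h3 c (by simp [hc])⟩, ⟨rfl, e2, fun c hc => h3 c (by simp [hc])⟩⟩

end Matchings

/-! ### Words along paths of a prefix code -/

section Paths

variable {S Γ : Type} (C : PrefixCode S Γ)

theorem pathWord_append (A v w : List S) :
    pathWord C A (v ++ w) = pathWord C A v ++ pathWord C (A ++ v) w := by
  induction v generalizing A with
  | nil => simp [pathWord]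
  | cons a v ih => simp [pathWord, ih]

@[simp] theorem pathWord_length (A w : List S) : (pathWord C A w).length = w.length := by
  induction w generalizing A with
  | nil => rfl
  | cons a w ih => simp [pathWord, ih]

@[simp] theorem between_append (A w : List S) : between C A (A ++ w) = pathWord C A w := by
  simp [between]

theorem encode_eq_pathWord (x : List S) : encode C x = pathWord C [] x := by
  simp [encode, between]

theorem encode_append (x w : List S) : encode C (x ++ w) = encode C x ++ pathWord C x w := by
  simp [encode_eq_pathWord, pathWord_append]

theorem encode_concat (x : List S) (a : S) :
    encode C (x ++ [a]) = encode C x ++ [C (x ++ [a])] := by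
  simp [encode_append, pathWord]

@[simp] theorem encode_length (x : List S) : (encode C x).length = x.length := by
  simp [encode_eq_pathWord]

end Paths

/-! ### Edit-distance tree codes over an alphabet of polynomial size -/

section TreeCodes

theorem pathWord_eq_map {S Γ : Type} (C : PrefixCode S Γ) (A w : List S) :
    pathWord C A w = (List.range w.length).map fun i => C (A ++ w.take (i + 1)) := by
  induction w using List.reverseRecOn with
  | nil => rfl
  | append_singleton w a ih =>
    rw [pathWord_append, ih, List.length_append, List.length_singleton, List.range_succ,
      List.map_append]
    congr 1
    · refine List.map_congr_left fun i hi => ?_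
      rw [List.take_append_of_le_length (by simpa using hi)]
    · rw [List.map_singleton, List.take_of_length_le (by simp)]
      simp [pathWord]

/-- A prefix code whose labels tell the depth and in which any two diverging paths of equal length
agree in at most half of their labels is an edit-distance tree code. -/
theorem isEditTreeCode_of_hamming {S Γ : Type} [DecidableEq Γ] {α : ℝ} (hα : α < 1) {N : ℕ}
    {C : PrefixCode S Γ}
    (hlen : ∀ x y : List S, x.length ≤ N → y.length ≤ N → C x = C y → x.length = y.length)
    (hdist : ∀ (B u w : List S) (m : ℕ), 1 ≤ m → m ≤ u.length → m ≤ w.length → B.length + m ≤ N →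
      u.head? ≠ w.head? → 2 * ((Finset.range m).filter fun i =>
        C (B ++ u.take (i + 1)) = C (B ++ w.take (i + 1))).card ≤ m) :
    IsEditTreeCode α N C := by
  rintro ⟨A, B, D, E, ⟨v, rfl⟩, ⟨u, rfl⟩, ⟨w, rfl⟩, hD, hE, hB, hDN, hEN, hed⟩
  have hu : u ≠ [] := by rintro rfl; simp at hD
  have hw : w ≠ [] := by rintro rfl; simp at hE
  have hu' := List.length_pos_iff.2 hu
  have hw' := List.length_pos_iff.2 hw
  have hhead : u.head? ≠ w.head? := by
    obtain ⟨a, u, rfl⟩ := List.exists_cons_of_ne_nil hu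
    obtain ⟨b, w, rfl⟩ := List.exists_cons_of_ne_nil hw
    intro h
    obtain rfl : a = b := by simpa using h
    have := hB (A ++ v ++ [a]) ⟨u, by simp⟩ ⟨w, by simp⟩
    simpa using this.length_le
  obtain ⟨t, t1, t2, t3⟩ := editDist_le_iff.1
    (le_refl (editDist (between C A (A ++ v ++ u)) (between C (A ++ v) (A ++ v ++ w))))
  have hd := hdist (A ++ v) u w (min u.length w.length) (by omega) (by omega) (by omega)
    (by simp at hDN ⊢; omega) hhead
  -- No label occurs twice on a path, since labels tell the depth. So the length of `t` is the
  -- number of its symbols, and each of them sits at the same depth on both paths. That depth is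
  -- below `B`, and within the first `min u.length w.length` steps.
  have ht : t.length ≤ ((Finset.range (min u.length w.length)).filter fun i =>
        C (A ++ v ++ u.take (i + 1)) = C (A ++ v ++ w.take (i + 1))).card := by
    have hnd : t.Nodup := by
      refine t2.nodup ?_
      rw [between_append, pathWord_eq_map]
      refine List.Nodup.map_on ?_ List.nodup_range
      intro i hi j hj h
      have := hlen _ _ (by simp at hEN ⊢; omega) (by simp at hEN ⊢; omega) h
      simp at this hi hj
      omega
    rw [← List.toFinset_card_of_nodup hnd]
    refine (Finset.card_le_card (t := Finset.image (fun i => C (A ++ v ++ w.take (i + 1)))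
      ((Finset.range (min u.length w.length)).filter fun i =>
        C (A ++ v ++ u.take (i + 1)) = C (A ++ v ++ w.take (i + 1)))) ?_).trans
      Finset.card_image_le
    intro x hx
    have hx1 := t1.subset (List.mem_toFinset.1 hx)
    have hx2 := t2.subset (List.mem_toFinset.1 hx)
    rw [List.append_assoc, between_append, pathWord_eq_map, List.mem_map] at hx1
    rw [between_append, pathWord_eq_map, List.mem_map] at hx2
    obtain ⟨i, hi, rfl⟩ := hx1
    obtain ⟨j, hj, hij⟩ := hx2
    rw [List.mem_range] at hi hj
    have hl := hlen _ _ (by simp at hEN ⊢; omega) (by simp at hDN ⊢; omega) hij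
    simp at hl hi
    obtain rfl : i = v.length + j := by omega
    refine Finset.mem_image.2 ⟨j, Finset.mem_filter.2 ⟨Finset.mem_range.2 (by omega), ?_⟩, hij⟩
    rw [hij, List.append_assoc, add_assoc, List.take_length_add_append]
  have e1 : (between C A (A ++ v ++ u)).length = v.length + u.length := by
    rw [List.append_assoc, between_append]; simp
  have e2 : (between C (A ++ v) (A ++ v ++ w)).length = w.length := by
    rw [between_append]; simp
  rw [e1, e2] at t3 hed
  -- The distance is at least the sum of the two lengths minus `2 * t.length`, and `2 * t.length` is
  -- at most the smaller of `u.length` and `w.length`.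
  have key : max (v.length + u.length) w.length ≤
      editDist (between C A (A ++ v ++ u)) (between C (A ++ v) (A ++ v ++ w)) := by omega
  have key' : (max (v.length + u.length : ℝ) (w.length : ℝ)) ≤
      editDist (between C A (A ++ v ++ u)) (between C (A ++ v) (A ++ v ++ w)) := by
    exact_mod_cast key
  have hpos : (0 : ℝ) < max (v.length + u.length : ℝ) (w.length : ℝ) :=
    lt_max_of_lt_right (by exact_mod_cast hw')
  push_cast at hed
  nlinarith

/-- The words `h` whose convolution with a fixed word `z`, `z 0 ≠ 0`, vanishes on `Z`. -/
theorem card_convolution_eq_zero_le {F : Type} [Field F] [Fintype F] [DecidableEq F] (N : ℕ)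
    (z : ℕ → F) (hz : z 0 ≠ 0) (Z : Finset ℕ) (hZ : Z ⊆ Finset.range N) :
    (Finset.univ.filter fun h : Fin N → F => ∀ i ∈ Z,
      ∑ j ∈ Finset.range (i + 1), (if hj : i - j < N then h ⟨i - j, hj⟩ else 0) * z j = 0).card ≤
      Fintype.card F ^ (N - Z.card) := by
  classical
  have hcard : Fintype.card ({i : Fin N // i.val ∉ Z} → F) = Fintype.card F ^ (N - Z.card) := by
    rw [Fintype.card_fun]
    congr 1
    rw [Fintype.card_subtype_compl, Fintype.card_fin, Fintype.card_subtype]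
    congr 1
    rw [← Finset.card_map (Fin.valEmbedding)]
    congr 1
    ext i
    simp only [Finset.mem_map, Finset.mem_filter, Finset.mem_univ, true_and, Fin.valEmbedding_apply]
    exact ⟨fun ⟨a, ha, e⟩ => e ▸ ha, fun h => ⟨⟨i, Finset.mem_range.1 (hZ h)⟩, h, rfl⟩⟩
  rw [← hcard, ← Finset.card_univ]
  refine Finset.card_le_card_of_injOn (fun h i => h i.1) (fun _ _ => Finset.mem_univ _) ?_
  intro h hh h' hh' heq
  simp only [Finset.coe_filter, Finset.mem_univ, true_and, Set.mem_ofPred_eq] at hh hh'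
  -- The system is triangular: the equation at `i ∈ Z` determines `h i` from smaller indices,
  -- because its leading coefficient `z 0` is invertible. Thus the values outside `Z` determine `h`.
  have key : ∀ i (hi : i < N), h ⟨i, hi⟩ = h' ⟨i, hi⟩ := by
    intro i
    induction i using Nat.strong_induction_on with
    | _ i ih =>
      intro hi
      by_cases hiZ : i ∈ Z
      · have h1 := (hh i hiZ).trans (hh' i hiZ).symm
        rw [Finset.sum_range_succ', Finset.sum_range_succ'] at h1
        have h2 : ∀ k ∈ Finset.range i,
            (if hj : i - (k + 1) < N then h ⟨i - (k + 1), hj⟩ else 0) * z (k + 1) =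
            (if hj : i - (k + 1) < N then h' ⟨i - (k + 1), hj⟩ else 0) * z (k + 1) := by
          intro k hk
          rw [Finset.mem_range] at hk
          rw [dif_pos (by omega), dif_pos (by omega), ih (i - (k + 1)) (by omega)]
        rw [Finset.sum_congr rfl h2] at h1
        have h3 := add_left_cancel h1
        simp only [Nat.sub_zero, dif_pos hi] at h3
        exact mul_right_cancel₀ hz h3
      · exact congrFun heq ⟨⟨i, hi⟩, hiZ⟩
  exact funext fun i => key i.1 i.2

/-- Most Toeplitz matrices give a tree code of relative distance `1 / 2`. -/
theorem exists_toeplitz {F S : Type} [Field F] [Fintype F] [DecidableEq F] [Fintype S] [Nonempty S]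
    (N : ℕ) (f : S → F) (hf : Function.Injective f)
    (hq : (4 * Fintype.card S ^ 2) ^ 2 ≤ Fintype.card F) :
    ∃ h : ℕ → F, ∀ m, 1 ≤ m → m ≤ N → ∀ u w : ℕ → S, u 0 ≠ w 0 →
      2 * ((Finset.range m).filter fun i =>
        ∑ j ∈ Finset.range (i + 1), h (i - j) * (f (u j) - f (w j)) = 0).card ≤ m := by
  classical
  set W := Fintype.card S ^ 2 with hW
  set q := Fintype.card F with hq'
  have hWpos : 1 ≤ W := Nat.one_le_pow _ _ Fintype.card_pos
  let z (m : ℕ) (p : Fin m → S × S) (j : ℕ) : F :=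
    if hj : j < m then f (p ⟨j, hj⟩).1 - f (p ⟨j, hj⟩).2 else 0
  let ext (h : Fin N → F) (i : ℕ) : F := if hi : i < N then h ⟨i, hi⟩ else 0
  -- The bad event for a pair `p` of words of length `m` and a set `Z` of agreements: `h` makes the
  -- hashes of the two words agree on `Z`, although their first symbols differ.
  let G (m : ℕ) (p : Fin m → S × S) (Z : Finset ℕ) : Finset (Fin N → F) :=
    Finset.univ.filter fun h => z m p 0 ≠ 0 ∧ ∀ i ∈ Z,
      ∑ j ∈ Finset.range (i + 1), ext h (i - j) * z m p j = 0
  let P (m : ℕ) : Finset (Finset ℕ) := (Finset.range m).powerset.filter fun Z => m < 2 * Z.card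
  let bad : Finset (Fin N → F) := (Finset.Icc 1 N).biUnion fun m =>
    (Finset.univ : Finset (Fin m → S × S)).biUnion fun p => (P m).biUnion fun Z => G m p Z
  have hqpos : (0 : ℝ) < q := by
    have : 0 < q := Fintype.card_pos
    exact_mod_cast this
  have hwpos : (0 : ℝ) < 4 * W := by
    have : (1 : ℝ) ≤ W := by exact_mod_cast hWpos
    linarith
  have hG : ∀ m ∈ Finset.Icc 1 N, ∀ p, ∀ Z ∈ P m,
      ((G m p Z).card : ℝ) ≤ (q : ℝ) ^ N / (4 * W) ^ (m + 1) := by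
    intro m hm p Z hZ
    simp only [P, Finset.mem_filter, Finset.mem_powerset] at hZ
    rw [Finset.mem_Icc] at hm
    have hZm : Z.card ≤ m := by simpa using Finset.card_le_card hZ.1
    rw [le_div_iff₀ (by positivity)]
    by_cases h0 : z m p 0 = 0
    · have : G m p Z = ∅ := by simp [G, h0]
      rw [this]; simp
    · have h1 : (G m p Z).card ≤ q ^ (N - Z.card) := by
        refine le_trans (le_of_eq ?_) (card_convolution_eq_zero_le N (z m p) h0 Z
          (hZ.1.trans (Finset.range_mono hm.2)))
        simp [G, h0, ext]
      -- More than half of the `m` places agree, so `m + 1 ≤ 2 * Z.card`; this is why the field has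
      -- at least `(4 * W) ^ 2` elements.
      have h2 : (4 * W) ^ (m + 1) ≤ q ^ Z.card :=
        calc (4 * W) ^ (m + 1) ≤ (4 * W) ^ (2 * Z.card) :=
              Nat.pow_le_pow_right (by omega) (by omega)
          _ = ((4 * W) ^ 2) ^ Z.card := by rw [pow_mul]
          _ ≤ q ^ Z.card := Nat.pow_le_pow_left hq _
      have h3 : (G m p Z).card * (4 * W) ^ (m + 1) ≤ q ^ N :=
        calc (G m p Z).card * (4 * W) ^ (m + 1) ≤ q ^ (N - Z.card) * q ^ Z.card :=
              Nat.mul_le_mul h1 h2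
          _ = q ^ N := by rw [← pow_add]; congr 1; omega
      exact_mod_cast h3
  -- There are `W ^ m` pairs of words and at most `2 ^ m` sets `Z`, so length `m` contributes at
  -- most `q ^ N / (4 * W) * (1 / 2) ^ m`. The geometric series leaves at most half of all `h`.
  have hbad : (bad.card : ℝ) < (q : ℝ) ^ N := by
    have hle : (bad.card : ℝ) ≤
        ∑ m ∈ Finset.Icc 1 N, (q : ℝ) ^ N / (4 * W) * (1 / 2) ^ m := by
      refine (Nat.cast_le.2 Finset.card_biUnion_le).trans ?_
      push_cast
      refine Finset.sum_le_sum fun m hm => ?_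
      refine (Nat.cast_le.2 Finset.card_biUnion_le).trans ?_
      push_cast
      have h1 : ∀ p : Fin m → S × S, (((P m).biUnion fun Z => G m p Z).card : ℝ) ≤
          2 ^ m * ((q : ℝ) ^ N / (4 * W) ^ (m + 1)) := by
        intro p
        refine (Nat.cast_le.2 Finset.card_biUnion_le).trans ?_
        push_cast
        refine (Finset.sum_le_card_nsmul _ _ _ (hG m hm p)).trans ?_
        rw [nsmul_eq_mul]
        refine mul_le_mul_of_nonneg_right ?_ (by positivity)
        have : (P m).card ≤ 2 ^ m := by
          refine (Finset.card_filter_le _ _).trans ?_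
          simp
        exact_mod_cast this
      refine (Finset.sum_le_card_nsmul _ _ _ fun p _ => h1 p).trans (le_of_eq ?_)
      rw [nsmul_eq_mul, Finset.card_univ, Fintype.card_fun, Fintype.card_prod, Fintype.card_fin,
        ← sq, ← hW, pow_succ, mul_pow, one_div, inv_pow]
      have : (W : ℝ) ^ m ≠ 0 := by positivity
      have h4 : (4 : ℝ) ^ m = 2 ^ m * 2 ^ m := by rw [← mul_pow]; norm_num
      rw [h4]
      push_cast
      field_simp
    refine hle.trans_lt ?_
    rw [← Finset.mul_sum]
    have hg : ∑ m ∈ Finset.Icc 1 N, (1 / 2 : ℝ) ^ m ≤ 2 := by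
      refine le_trans ?_ (sum_geometric_two_le (N + 1))
      refine Finset.sum_le_sum_of_subset_of_nonneg ?_ fun _ _ _ => by positivity
      intro i hi
      rw [Finset.mem_Icc] at hi
      exact Finset.mem_range.2 (by omega)
    have hW1 : (1 : ℝ) ≤ W := by exact_mod_cast hWpos
    have hqN : (0 : ℝ) < (q : ℝ) ^ N := by positivity
    calc (q : ℝ) ^ N / (4 * W) * ∑ m ∈ Finset.Icc 1 N, (1 / 2 : ℝ) ^ m
        ≤ (q : ℝ) ^ N / (4 * W) * 2 := mul_le_mul_of_nonneg_left hg (by positivity)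
      _ < (q : ℝ) ^ N := by
        rw [div_mul_eq_mul_div, div_lt_iff₀ hwpos]
        nlinarith
  obtain ⟨h, hh⟩ : ∃ h, h ∉ bad := by
    by_contra! hall
    have : bad = Finset.univ := Finset.eq_univ_iff_forall.2 hall
    rw [this, Finset.card_univ, Fintype.card_fun, Fintype.card_fin] at hbad
    push_cast at hbad
    exact lt_irrefl _ hbad
  refine ⟨ext h, fun m hm hmN u w huw => ?_⟩
  by_contra! hlt
  refine hh ?_
  have hz : ∀ j, j < m → z m (fun i => (u i, w i)) j = f (u j) - f (w j) := fun j hj => by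
    simp [z, hj]
  simp only [bad, Finset.mem_biUnion]
  refine ⟨m, Finset.mem_Icc.2 ⟨hm, hmN⟩, fun i => (u i, w i), Finset.mem_univ _, _,
    Finset.mem_filter.2 ⟨Finset.mem_powerset.2 (Finset.filter_subset _ _), hlt⟩, ?_⟩
  simp only [G, Finset.mem_filter, Finset.mem_univ, true_and]
  refine ⟨?_, ?_⟩
  · rw [hz 0 (by omega)]
    exact sub_ne_zero.2 (hf.ne huw)
  · rintro i ⟨hi, hsum⟩
    rw [← hsum]
    rw [Finset.mem_range] at hi
    refine Finset.sum_congr rfl fun j hj => ?_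
    rw [Finset.mem_range] at hj
    rw [hz j (by omega)]

/-- Edit-distance tree codes of depth `N` exist over an alphabet of size polynomial in `N` and in
the size of the input alphabet. -/
theorem exists_isEditTreeCode {S : Type} [Fintype S] [Nonempty S] (N : ℕ) :
    ∃ q : ℕ, q ≤ (N + 1) * (32 * Fintype.card S ^ 4) ∧ ∃ C : PrefixCode S (Fin q),
      ∀ α : ℝ, α < 1 → IsEditTreeCode α N C := by
  classical
  have hS : 1 ≤ Fintype.card S := Fintype.card_pos
  -- Bertrand's postulate keeps the field, and with it the output alphabet, of polynomial size.
  obtain ⟨p, hp, hlt, hle⟩ := Nat.exists_prime_lt_and_le_two_mul ((4 * Fintype.card S ^ 2) ^ 2)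
    (by positivity)
  have : Fact p.Prime := ⟨hp⟩
  have hcard : Fintype.card (ZMod p) = p := ZMod.card p
  have hSp : Fintype.card S ≤ Fintype.card (ZMod p) := by
    rw [hcard]
    nlinarith [Nat.le_self_pow (n := 4) (by norm_num) (Fintype.card S)]
  obtain ⟨f⟩ := Function.Embedding.nonempty_of_card_le hSp
  obtain ⟨h, hh⟩ := exists_toeplitz N f f.injective (by rw [hcard]; exact hlt.le)
  let val (x : List S) (j : ℕ) : ZMod p := (x[j]?).elim 0 f
  let hash (x : List S) : ZMod p := ∑ j ∈ Finset.range x.length, h (x.length - 1 - j) * val x j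
  have hcard' : Fintype.card (Fin (N + 1) × ZMod p) = (N + 1) * p := by simp
  let e : Fin (N + 1) × ZMod p ≃ Fin ((N + 1) * p) := Fintype.equivFinOfCardEq hcard'
  refine ⟨(N + 1) * p, Nat.mul_le_mul_left _ (hle.trans (le_of_eq (by ring))),
    fun x => e (Fin.ofNat (N + 1) x.length, hash x), fun α hα => ?_⟩
  refine isEditTreeCode_of_hamming hα ?_ ?_
  · intro x y hx hy hxy
    have h1 := congrArg (fun t => (Prod.fst t).val) (e.injective hxy)
    simp only [Fin.ofNat_eq_cast, Fin.val_natCast] at h1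
    rwa [Nat.mod_eq_of_lt (by omega), Nat.mod_eq_of_lt (by omega)] at h1
  · intro B u w m hm hmu hmw hBm huw
    have s₀ : S := Classical.arbitrary S
    have hu0 : u.getD 0 s₀ ≠ w.getD 0 s₀ := by
      obtain ⟨a, u, rfl⟩ := List.exists_cons_of_ne_nil (List.length_pos_iff.1 (hm.trans hmu))
      obtain ⟨b, w, rfl⟩ := List.exists_cons_of_ne_nil (List.length_pos_iff.1 (hm.trans hmw))
      simpa using huw
    refine le_trans (Nat.mul_le_mul_left 2 (Finset.card_le_card ?_))
      (hh m hm (by omega) (fun j => u.getD j s₀) (fun j => w.getD j s₀) hu0)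
    intro i hi
    rw [Finset.mem_filter, Finset.mem_range] at hi ⊢
    refine ⟨hi.1, ?_⟩
    have hhash : hash (B ++ u.take (i + 1)) = hash (B ++ w.take (i + 1)) :=
      congrArg Prod.snd (e.injective hi.2)
    -- The contribution of the common prefix `B` is the same for both words and cancels. What
    -- remains is a convolution that starts at the branching point, because the matrix is Toeplitz.
    have expand : ∀ t : List S, m ≤ t.length → hash (B ++ t.take (i + 1)) =
        ∑ j ∈ Finset.range B.length, h (B.length + i - j) * val B j +
        ∑ j ∈ Finset.range (i + 1), h (i - j) * f (t.getD j s₀) := by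
      intro t ht
      have hl : (B ++ t.take (i + 1)).length = B.length + (i + 1) := by simp; omega
      simp only [hash]
      rw [hl, Finset.sum_range_add]
      congr 1
      · refine Finset.sum_congr rfl fun j hj => ?_
        rw [Finset.mem_range] at hj
        simp only [val]
        rw [List.getElem?_append_left hj]
        rfl
      · refine Finset.sum_congr rfl fun j hj => ?_
        rw [Finset.mem_range] at hj
        have hjt : j < t.length := by omega
        simp only [val]
        rw [List.getElem?_append_right (by omega), Nat.add_sub_cancel_left,
          List.getElem?_take_of_lt hj, List.getElem?_eq_getElem hjt,
          List.getD_eq_getElem?_getD, List.getElem?_eq_getElem hjt]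
        simp only [Option.elim_some, Option.getD_some]
        congr 2
        omega
    rw [expand u hmu, expand w hmw] at hhash
    simp only [mul_sub, Finset.sum_sub_distrib]
    exact sub_eq_zero.2 (add_left_cancel hhash)

end TreeCodes

/-! ### Unique decoding -/

section Decoding

variable {S Γ : Type}

/-- In every nonempty suffix, the number of blanks is at most `γ / 2` times the number of
non-blanks of the first row. -/
def SuffixBound (γ : ℝ) (τ : Columns Γ) : Prop :=
  ∀ σ : Columns Γ, σ ≠ [] → σ <:+ τ →
    2 * ((blanks₁ σ + blanks₂ σ : ℕ) : ℝ) ≤ γ * ((σ.length - blanks₁ σ : ℕ) : ℝ)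

theorem SuffixBound.of_suffix {γ : ℝ} {σ τ : Columns Γ} (h : SuffixBound γ τ) (hσ : σ <:+ τ) :
    SuffixBound γ σ := fun σ' h0 h1 => h σ' h0 (h1.trans hσ)

theorem SuffixBound.le {γ : ℝ} {τ : Columns Γ} {s r : List Γ} (h : SuffixBound γ τ)
    (hτ : IsMatching τ s r) : 2 * ((blanks₁ τ + blanks₂ τ : ℕ) : ℝ) ≤ γ * (s.length : ℝ) := by
  by_cases h0 : τ = []
  · subst h0
    simp [← hτ.1]
  · have := h τ h0 List.suffix_rfl
    rwa [← hτ.length_fst, Nat.add_sub_cancel] at this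

theorem blanks₁_le_length (τ : Columns Γ) : blanks₁ τ ≤ τ.length := List.countP_le_length

theorem suffixDist_le_of_suffixBound {β : ℝ} {τ : Columns Γ} {s r : List Γ}
    (hτ : IsMatching τ s r) (h : SuffixBound β τ) : suffixDist s r ≤ ENNReal.ofReal (β / 2) := by
  refine (iInf₂_le τ hτ).trans (iSup₂_le fun σ hσ => ?_)
  have h1 := h σ hσ.1 hσ.2
  -- A nonempty suffix without symbols in the first row has a blank in each column, which the bound
  -- forbids; so the quotient is finite.
  have hpos : σ.length - blanks₁ σ ≠ 0 := by
    intro h0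
    rw [h0] at h1
    have hl := List.length_pos_iff.2 hσ.1
    have : (1 : ℝ) ≤ ((blanks₁ σ + blanks₂ σ : ℕ) : ℝ) := by
      exact_mod_cast (by omega : 1 ≤ blanks₁ σ + blanks₂ σ)
    simp at h1 this
    linarith
  have hpos' : (0 : ℝ) < ((σ.length - blanks₁ σ : ℕ) : ℝ) := by
    exact_mod_cast Nat.pos_of_ne_zero hpos
  rw [← ENNReal.ofReal_natCast, ← ENNReal.ofReal_natCast, ← ENNReal.ofReal_div_of_pos hpos']
  refine ENNReal.ofReal_le_ofReal ?_
  rw [div_le_iff₀ hpos']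
  linarith

/-- The strict inequality yields a witness from the infimum without showing that it is attained. -/
theorem exists_suffixBound_of_suffixDist_lt {γ : ℝ} (hγ : 0 ≤ γ) {s r : List Γ}
    (h : suffixDist s r < ENNReal.ofReal (γ / 2)) :
    ∃ τ : Columns Γ, IsMatching τ s r ∧ SuffixBound γ τ := by
  obtain ⟨τ, h⟩ := iInf_lt_iff.1 h
  obtain ⟨hτ, h⟩ := iInf_lt_iff.1 h
  refine ⟨τ, hτ, fun σ h0 hσ => ?_⟩
  have h1 := (le_iSup₂ (f := fun (σ : Columns Γ) (_ : σ ≠ [] ∧ σ <:+ τ) =>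
    ((blanks₁ σ + blanks₂ σ : ℕ) : ℝ≥0∞) / ((σ.length - blanks₁ σ : ℕ) : ℝ≥0∞)) σ ⟨h0, hσ⟩).trans
    h.le
  have hl := List.length_pos_iff.2 h0
  have hpos : σ.length - blanks₁ σ ≠ 0 := by
    intro h0
    rw [h0, Nat.cast_zero, ENNReal.div_zero] at h1
    · simp at h1
    · exact_mod_cast (by omega : blanks₁ σ + blanks₂ σ ≠ 0)
  have hpos' : (0 : ℝ) < ((σ.length - blanks₁ σ : ℕ) : ℝ) := by
    exact_mod_cast Nat.pos_of_ne_zero hpos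
  rw [← ENNReal.ofReal_natCast, ← ENNReal.ofReal_natCast, ← ENNReal.ofReal_div_of_pos hpos',
    ENNReal.ofReal_le_ofReal_iff (by positivity), div_le_iff₀ hpos'] at h1
  linarith

/-- Restricting a string matching from `encode C x` to a suffix of the received word. -/
theorem exists_between_matching (C : PrefixCode S Γ) {γ : ℝ} {τ : Columns Γ} {x : List S}
    {r₁ r₂ : List Γ} (hτ : IsMatching τ (encode C x) (r₁ ++ r₂)) (hγ : SuffixBound γ τ) :
    ∃ A v τ', x = A ++ v ∧ τ' <:+ τ ∧ IsMatching τ' (between C A x) r₂ ∧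
      2 * ((blanks₁ τ' + blanks₂ τ' : ℕ) : ℝ) ≤ γ * (v.length : ℝ) := by
  obtain ⟨τ₁, τ₂, s₁, s₂, rfl, hs, h1, h2⟩ := hτ.split_snd
  have hl : s₁.length ≤ x.length := by
    have := congrArg List.length hs
    simp at this; omega
  obtain ⟨A, v, rfl, hA⟩ : ∃ A v, x = A ++ v ∧ A.length = s₁.length :=
    ⟨x.take s₁.length, x.drop s₁.length, by simp, by simp [hl]⟩
  rw [encode_append] at hs
  obtain ⟨-, hs₂⟩ := List.append_inj hs (by simp [hA])
  have h3 := (hγ.of_suffix ⟨τ₁, rfl⟩).le h2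
  rw [← hs₂] at h2 h3
  exact ⟨A, v, τ₂, rfl, ⟨τ₁, rfl⟩, by rwa [between_append], by simpa using h3⟩

/-- Counterpart of `exists_between_matching`: here the cut is made on the sent side, at the node
`B`. -/
theorem exists_suffix_matching (C : PrefixCode S Γ) {γ : ℝ} {τ : Columns Γ} {B v : List S}
    {r : List Γ} (hτ : IsMatching τ (encode C (B ++ v)) r) (hγ : SuffixBound γ τ) :
    ∃ τ' r₁ r₂, r = r₁ ++ r₂ ∧ τ' <:+ τ ∧ IsMatching τ' (between C B (B ++ v)) r₂ ∧
      2 * ((blanks₁ τ' + blanks₂ τ' : ℕ) : ℝ) ≤ γ * (v.length : ℝ) := by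
  rw [encode_append] at hτ
  obtain ⟨τ₁, τ₂, r₁, r₂, rfl, hr, h1, h2⟩ := hτ.split_fst
  have h3 := (hγ.of_suffix ⟨τ₁, rfl⟩).le h2
  exact ⟨τ₂, r₁, r₂, hr, ⟨τ₁, rfl⟩, by rwa [between_append], by simpa using h3⟩

theorem isPrefix_of_ne_head {B u w G : List S} (h : u.head? ≠ w.head?) (hu : G <+: B ++ u)
    (hw : G <+: B ++ w) : G <+: B := by
  by_contra hG
  have hlt : B.length < G.length := by
    by_contra! hle
    exact hG (List.prefix_of_prefix_length_le hu ⟨u, rfl⟩ hle)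
  obtain ⟨t, rfl⟩ := List.prefix_of_prefix_length_le (List.prefix_append B u) hu hlt.le
  obtain ⟨a, t, rfl⟩ := List.exists_cons_of_ne_nil (l := t) (by rintro rfl; simp at hlt)
  obtain ⟨u', hu'⟩ := (List.prefix_append_right_inj B).1 hu
  obtain ⟨w', hw'⟩ := (List.prefix_append_right_inj B).1 hw
  rw [← hu', ← hw'] at h
  simp at h

/-- By the triangle inequality through `r`, the distance is at most (1 - 2ε) times the mean of the
two lengths, hence at most (1 - ε) times their maximum. -/
theorem hasBadLambda_of_matchings (C : PrefixCode S Γ) {ε : ℝ} (hε : 0 < ε) {N : ℕ}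
    {τ τ' : Columns Γ} {A v B u w : List S} {r : List Γ} (hAv : A ++ v = B ++ u) (hAB : A <+: B)
    (hτ : IsMatching τ (between C A (B ++ u)) r) (hτ' : IsMatching τ' (between C B (B ++ w)) r)
    (hb : 2 * ((blanks₁ τ + blanks₂ τ : ℕ) : ℝ) ≤ (1 - 2 * ε) * (v.length : ℝ))
    (hb' : 2 * ((blanks₁ τ' + blanks₂ τ' : ℕ) : ℝ) ≤ (1 - 2 * ε) * (w.length : ℝ))
    (hu : u ≠ []) (hw : w ≠ []) (huw : u.head? ≠ w.head?)
    (hN : (B ++ u).length ≤ N) (hN' : (B ++ w).length ≤ N) (hε' : ε ≤ 1 / 18) :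
    HasBadLambda (1 - ε) N C := by
  refine ⟨A, B, B ++ u, B ++ w, hAB, List.prefix_append _ _, List.prefix_append _ _,
    by simpa using hu, by simpa using hw, fun G h1 h2 => isPrefix_of_ne_head huw h1 h2, hN, hN', ?_⟩
  have h1 : (editDist (between C A (B ++ u)) (between C B (B ++ w)) : ℝ) ≤
      ((blanks₁ τ + blanks₂ τ : ℕ) : ℝ) + ((blanks₁ τ' + blanks₂ τ' : ℕ) : ℝ) := by
    exact_mod_cast editDist_le_of_isMatching hτ hτ'
  rw [← hAv, between_append, between_append, pathWord_length, pathWord_length, hAv] at *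
  have h2 := le_max_left (v.length : ℝ) (w.length : ℝ)
  have h3 := le_max_right (v.length : ℝ) (w.length : ℝ)
  have h4 : (0 : ℝ) ≤ v.length := by positivity
  nlinarith

/-- A path and an extension of it cannot both be close to the received word: otherwise, after the
shorter path is prolonged in another direction, there is a bad lambda. -/
theorem hasBadLambda_of_prefix [Nontrivial S] (C : PrefixCode S Γ) {ε : ℝ} (hε : 0 < ε)
    (hε' : ε ≤ 1 / 18) {N : ℕ} {τ τ' : Columns Γ} {B w : List S} {r : List Γ}
    (hτ : IsMatching τ (encode C B) r) (hτ' : IsMatching τ' (encode C (B ++ w)) r)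
    (hγ : SuffixBound (1 - 2 * ε) τ) (hγ' : SuffixBound (1 - 2 * ε) τ') (hw : w ≠ [])
    (hN : (B ++ w).length ≤ N) : HasBadLambda (1 - ε) N C := by
  obtain ⟨σ', r₁, r₂, rfl, -, m', c'⟩ := exists_suffix_matching C hτ' hγ'
  obtain ⟨A, v, σ, rfl, -, m, c⟩ := exists_between_matching C hτ hγ
  obtain ⟨a, w, rfl⟩ := List.exists_cons_of_ne_nil hw
  obtain ⟨b, hb⟩ := exists_ne a
  refine ⟨A, A ++ v, A ++ v ++ [b], A ++ v ++ a :: w, List.prefix_append _ _,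
    List.prefix_append _ _, List.prefix_append _ _, by simp, by simp,
    fun G h1 h2 => isPrefix_of_ne_head (by simpa using hb) h1 h2, ?_, hN, ?_⟩
  · simp at hN ⊢; omega
  have hed : editDist (between C A (A ++ v ++ [b])) (between C (A ++ v) (A ++ v ++ a :: w)) ≤
      blanks₁ σ + blanks₂ σ + (blanks₁ σ' + blanks₂ σ') + 1 := by
    rw [List.append_assoc, between_append, pathWord_append]
    refine (editDist_append_le _ _ _).trans ?_
    rw [pathWord_length, List.length_singleton]
    rw [between_append] at m
    exact Nat.add_le_add_right (editDist_le_of_isMatching m m') 1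
  -- If `v` were empty, `σ` would have no blanks and `r₂` would be empty, so that all symbols of `a
  -- :: w` would be set against blanks, more than `c'` allows.
  have hv : 1 ≤ v.length := by
    by_contra! h0
    have hv0 : v = [] := List.length_eq_zero_iff.1 (by omega)
    subst hv0
    have e1 : blanks₁ σ + blanks₂ σ = 0 := by
      have : ((blanks₁ σ + blanks₂ σ : ℕ) : ℝ) ≤ 0 := by simp at c ⊢; linarith
      exact_mod_cast le_antisymm this (by positivity)
    have l1 := m.length_fst
    have l2 := m.length_snd
    have l3 := m'.length_snd
    have l4 := m'.length_fst
    rw [between_append, pathWord_length] at l1 l4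
    simp only [List.length_nil, List.length_cons] at l1 l4 c'
    have e2 : w.length + 1 ≤ blanks₁ σ' + blanks₂ σ' := by omega
    have e3 : ((w.length + 1 : ℕ) : ℝ) ≤ ((blanks₁ σ' + blanks₂ σ' : ℕ) : ℝ) := by exact_mod_cast e2
    have e4 : (0 : ℝ) < ((w.length + 1 : ℕ) : ℝ) := by positivity
    nlinarith
  have l1 : (between C A (A ++ v ++ [b])).length = v.length + 1 := by
    rw [List.append_assoc, between_append]; simp
  have l2 : (between C (A ++ v) (A ++ v ++ a :: w)).length = w.length + 1 := by
    rw [between_append]; simp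
  rw [l1, l2]
  simp only [List.length_cons] at c'
  generalize blanks₁ σ + blanks₂ σ = x at *
  generalize blanks₁ σ' + blanks₂ σ' = y at *
  generalize v.length = p at *
  generalize w.length + 1 = q at *
  refine (Nat.cast_le.2 hed).trans ?_
  have hp1 : (1 : ℝ) ≤ p := by exact_mod_cast hv
  have hα : 0 ≤ 1 - ε := by linarith
  push_cast
  rcases le_or_gt q p with hqp | hqp
  · refine le_trans ?_ (mul_le_mul_of_nonneg_left (le_max_left _ _) hα)
    have : (q : ℝ) ≤ p := by exact_mod_cast hqp
    nlinarith
  · refine le_trans ?_ (mul_le_mul_of_nonneg_left (le_max_right _ _) hα)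
    rcases Nat.lt_or_ge (p + 1) q with h | h
    · have : (p : ℝ) + 2 ≤ q := by exact_mod_cast h
      nlinarith
    · obtain rfl : q = p + 1 := by omega
      push_cast at *
      -- For lengths `p` and `p + 1` the slack ε absorbs the extra edge only if `1 / 2 ≤ ε * p`. For
      -- shorter paths integrality helps: `2 * x < p` and `2 * y < p + 1` force `x + y + 1 ≤ p`.
      by_cases hlarge : 1 / 2 + ε ≤ ε * (p + 1)
      · nlinarith
      · have hx : 2 * x < p := by
          have : (2 * x : ℝ) < p := by nlinarith
          exact_mod_cast this
        have hy : 2 * y < p + 1 := by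
          have : (2 * y : ℝ) < p + 1 := by nlinarith
          exact_mod_cast this
        have hxy : x + y + 1 ≤ p := by omega
        have : (x + y + 1 : ℝ) ≤ p := by exact_mod_cast hxy
        nlinarith

theorem exists_common_prefix (x y : List S) : ∃ B u w, x = B ++ u ∧ y = B ++ w ∧
    (u = [] ∨ w = [] ∨ u ≠ [] ∧ w ≠ [] ∧ u.head? ≠ w.head?) := by
  classical
  induction x generalizing y with
  | nil => exact ⟨[], [], y, rfl, rfl, Or.inl rfl⟩
  | cons a x ih =>
    cases y with
    | nil => exact ⟨[], a :: x, [], rfl, rfl, Or.inr (Or.inl rfl)⟩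
    | cons b y =>
      by_cases hab : a = b
      · subst hab
        obtain ⟨B, u, w, rfl, rfl, h⟩ := ih y
        exact ⟨a :: B, u, w, rfl, rfl, h⟩
      · exact ⟨[], a :: x, b :: y, rfl, rfl, Or.inr (Or.inr ⟨by simp, by simp, by simpa using hab⟩)⟩

/-- In an edit-distance tree code, at most one message is close in suffix distance to a given
received word. -/
theorem eq_of_suffixBound [Nontrivial S] {C : PrefixCode S Γ} {ε : ℝ} (hε : 0 < ε)
    (hε' : ε ≤ 1 / 18) {N : ℕ} (hC : IsEditTreeCode (1 - ε) N C) {τ τ' : Columns Γ} {x y : List S}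
    {r : List Γ} (hτ : IsMatching τ (encode C x) r) (hτ' : IsMatching τ' (encode C y) r)
    (hγ : SuffixBound (1 - 2 * ε) τ) (hγ' : SuffixBound (1 - 2 * ε) τ') (hx : x.length ≤ N)
    (hy : y.length ≤ N) : x = y := by
  by_contra hne
  obtain ⟨B, u, w, rfl, rfl, h⟩ := exists_common_prefix x y
  rcases h with rfl | rfl | ⟨hu, hw, huw⟩
  · rw [List.append_nil] at hτ
    exact hC (hasBadLambda_of_prefix C hε hε' hτ hτ' hγ hγ' (by rintro rfl; simp at hne) hy)
  · rw [List.append_nil] at hτ'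
    exact hC (hasBadLambda_of_prefix C hε hε' hτ' hτ hγ' hγ (by rintro rfl; simp at hne) hx)
  · have key : ∀ (τ τ' : Columns Γ) (u w : List S) (r₁ r₂ r₃ : List Γ) (σ σ' : Columns Γ),
        SuffixBound (1 - 2 * ε) τ → IsMatching τ (encode C (B ++ u)) (r₁ ++ (r₂ ++ r₃)) →
        σ <:+ τ → IsMatching σ (between C B (B ++ u)) r₃ →
        IsMatching σ' (between C B (B ++ w)) (r₂ ++ r₃) →
        2 * ((blanks₁ σ + blanks₂ σ : ℕ) : ℝ) ≤ (1 - 2 * ε) * (u.length : ℝ) →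
        2 * ((blanks₁ σ' + blanks₂ σ' : ℕ) : ℝ) ≤ (1 - 2 * ε) * (w.length : ℝ) →
        u ≠ [] → w ≠ [] → u.head? ≠ w.head? → (B ++ u).length ≤ N → (B ++ w).length ≤ N →
        HasBadLambda (1 - ε) N C := by
      intro τ τ' u w r₁ r₂ r₃ σ σ' hγ hτ hσ mσ mσ' cσ cσ' hu hw huw hx hy
      by_cases h2 : r₂ = []
      · subst h2
        exact hasBadLambda_of_matchings C hε rfl List.prefix_rfl mσ mσ' cσ cσ' hu hw huw hx hy hε'
      -- The part of the word that matches `B ++ w` below `B` is longer than the part for `B ++ u`.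
      -- The path to `B ++ u` is therefore started higher up, at `A`, so that both paths face the
      -- same received suffix; this is the handle of the lambda.
      · obtain ⟨A, v, ω, hAv, hω, mω, cω⟩ := exists_between_matching C hτ hγ
        refine hasBadLambda_of_matchings C hε hAv.symm ?_ mω mσ' cω cσ' hu hw huw hx hy hε'
        have hσω : σ <:+ ω := by
          rcases List.suffix_or_suffix_of_suffix hσ hω with h | h
          · exact h
          · exfalso
            obtain ⟨κ, rfl⟩ := h
            have h3 := mσ.2.1
            rw [List.filterMap_append, mω.2.1] at h3
            have := congrArg List.length h3
            have := List.length_pos_iff.2 h2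
            simp at *
            omega
        obtain ⟨κ, rfl⟩ := hσω
        have h3 := mω.1
        rw [List.filterMap_append, mσ.1] at h3
        have h4 := congrArg List.length h3
        rw [hAv, between_append, ← hAv, between_append] at h4
        simp only [List.length_append, pathWord_length] at h4
        have h5 := congrArg List.length hAv
        simp only [List.length_append] at h5
        exact List.prefix_of_prefix_length_le (hAv ▸ List.prefix_append A v)
          (List.prefix_append B u) (by omega)
    obtain ⟨σ, r₁, r₂, hr, hs, m, c⟩ := exists_suffix_matching C hτ hγ
    obtain ⟨σ', r₁', r₂', hr', hs', m', c'⟩ := exists_suffix_matching C hτ' hγ'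
    -- The two received parts are suffixes of one word, hence nested; the branch with the shorter
    -- part takes the role of `u` in `key`.
    rcases List.suffix_or_suffix_of_suffix (l₁ := r₂) (l₂ := r₂') ⟨r₁, hr.symm⟩ ⟨r₁', hr'.symm⟩ with
      ⟨t, rfl⟩ | ⟨t, rfl⟩
    · exact hC (key τ τ' u w _ _ _ σ σ' hγ (hr' ▸ hτ) hs m m' c c' hu hw huw hx hy)
    · exact hC (key τ' τ w u _ _ _ σ' σ hγ' (hr ▸ hτ') hs' m' m c' c hw hu huw.symm hy hx)

/-- If the blanks of the actual string matching are rare in all suffixes, the receiver decodes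
correctly. -/
theorem Choices.dec_eq {T N : ℕ} {C : PrefixCode (Sym N) Γ} (ch : Choices T N C) {ε β : ℝ}
    (hε : 0 < ε) (hε' : ε ≤ 1 / 18) (hβ : β < 1 - 2 * ε) (hC : IsEditTreeCode (1 - ε) N C)
    {τ : Columns Γ} {x : List (Sym N)} {r : List Γ} (hτ : IsMatching τ (encode C x) r)
    (hb : SuffixBound β τ) (hx : x.length ≤ N) : ch.dec r = x := by
  have h1 := (ch.dec_min r x hx).trans (suffixDist_le_of_suffixBound hτ hb)
  -- The gap between β and 1 - 2ε turns the minimality of the decoded message into the strict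
  -- inequality that provides a matching.
  have h2 : ENNReal.ofReal (β / 2) < ENNReal.ofReal ((1 - 2 * ε) / 2) :=
    (ENNReal.ofReal_lt_ofReal_iff (by linarith)).2 (by linarith)
  obtain ⟨τ', hτ', hb'⟩ := exists_suffixBound_of_suffixDist_lt (by linarith) (h1.trans_lt h2)
  refine eq_of_suffixBound hε hε' hC hτ' hτ hb' ?_ (ch.dec_length r) hx
  intro σ h0 hσ
  refine (hb σ h0 hσ).trans (mul_le_mul_of_nonneg_right hβ.le (by positivity))

end Decoding

/-! ### The number of bad decodings -/

section BadCount

variable {Γ : Type}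

open Classical in
/-- The number of received symbols after which some suffix of the string matching has too many
blanks. The columns are listed with the newest first. -/
noncomputable def badCount (β : ℝ) : Columns Γ → ℕ
  | [] => 0
  | c :: τ => badCount β τ + if c.2.isSome ∧ ¬ SuffixBound β (c :: τ).reverse then 1 else 0

theorem badCount_le_cons (β : ℝ) (c : Option Γ × Option Γ) (τ : Columns Γ) :
    badCount β τ ≤ badCount β (c :: τ) := Nat.le_add_right _ _

/-- Only columns with a received symbol are counted, and `σ` has `σ.length - blanks₂ σ` of them. -/
theorem badCount_append_le (β : ℝ) (σ τ : Columns Γ) :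
    badCount β (σ ++ τ) + blanks₂ σ ≤ badCount β τ + σ.length := by
  induction σ with
  | nil => simp
  | cons c σ ih =>
    rw [List.cons_append, badCount, blanks₂_cons, List.length_cons]
    obtain ⟨a, _ | b⟩ := c
    · simp; omega
    · simp only [Option.isNone_some]
      split_ifs <;> simp_all <;> omega

theorem blanks₁_reverse (τ : Columns Γ) : blanks₁ τ.reverse = blanks₁ τ := List.countP_reverse

theorem blanks₂_reverse (τ : Columns Γ) : blanks₂ τ.reverse = blanks₂ τ := List.countP_reverse

/-- If the newest column is bad, remove a whole violating suffix `σ`. It contains at most `σ.length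
- blanks₂ σ` counted columns, while the violation says that β times `σ.length - blanks₁ σ` is below
twice its number of blanks. So `σ` pays for all its counted columns, and induction handles the rest.
-/
theorem badCount_le {β : ℝ} (h0 : 0 ≤ β) (h2 : β ≤ 2) (τ : Columns Γ) :
    β * badCount β τ ≤ 2 * (blanks₁ τ + blanks₂ τ) + β * (blanks₁ τ - blanks₂ τ) := by
  induction hn : τ.length using Nat.strong_induction_on generalizing τ with
  | _ n ih =>
    cases τ with
    | nil => simp [badCount]
    | cons c τ =>
      by_cases hb : c.2.isSome ∧ ¬ SuffixBound β (c :: τ).reverse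
      · obtain ⟨-, hb⟩ := hb
        simp only [SuffixBound, not_forall, not_le] at hb
        obtain ⟨σ, hσ0, ⟨κ, hκ⟩, hσ⟩ := hb
        have e : c :: τ = σ.reverse ++ κ.reverse := by
          rw [← List.reverse_append, hκ, List.reverse_reverse]
        have hl := congrArg List.length e
        have hσl := List.length_pos_iff.2 hσ0
        simp only [List.length_append, List.length_reverse] at hl
        have h3 := ih κ.reverse.length (by simp; omega) κ.reverse rfl
        have h4 : (badCount β (σ.reverse ++ κ.reverse) : ℝ) + blanks₂ σ ≤
            badCount β κ.reverse + σ.length := by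
          have := badCount_append_le β σ.reverse κ.reverse
          rw [blanks₂_reverse, List.length_reverse] at this
          exact_mod_cast this
        rw [Nat.cast_sub (blanks₁_le_length σ)] at hσ
        rw [e, blanks₁_append, blanks₂_append, blanks₁_reverse σ, blanks₂_reverse σ]
        push_cast at *
        nlinarith
      · have h3 := ih τ.length (by rw [← hn]; simp) τ rfl
        -- A column that is not counted does not lower the right side: a blank in the first row adds
        -- `2 + β`, one in the second `2 - β ≥ 0`.
        rw [badCount, if_neg hb, blanks₁_cons, blanks₂_cons]
        push_cast
        split_ifs <;> simp <;> nlinarith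

end BadCount

/-! ### The correct path -/

section Path

theorem Party.parity_lt_two (p : Party) : p.parity < 2 := by cases p <;> decide

theorem Party.parity_other (p : Party) : p.other.parity = 1 - p.parity := by cases p <;> rfl

theorem Party.other_other (p : Party) : p.other.other = p := by cases p <;> rfl

theorem Party.other_ne (p : Party) : p.other ≠ p := by cases p <;> decide

theorem Party.eq_or_eq_other (p q : Party) : q = p ∨ q = p.other := by
  cases p <;> cases q <;> simp [Party.other]

theorem IsPathIn.of_prefix {S : Set Edge} {v w : List Bool} (h : IsPathIn S v) (hw : w <+: v) :
    IsPathIn S w := fun e h0 he => h e h0 (he.trans hw)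

theorem IsPathIn.mono {S S' : Set Edge} {v : List Bool} (h : IsPathIn S v) (hS : S ⊆ S') :
    IsPathIn S' v := fun e h0 he => hS (h e h0 he)

theorem IsInput.length_mod {T : ℕ} {p : Party} {X : Set Edge} (hX : IsInput T p X) {e : Edge}
    (he : e ∈ X) : 1 ≤ e.length ∧ e.length ≤ T ∧ (e.length + 1) % 2 = p.parity := by
  obtain ⟨v, b, rfl, hT, hp⟩ := hX.1 e he
  simp
  omega

variable {T : ℕ} {X : Party → Set Edge} {v : List Bool}

theorem mem_union_inputs {e : Edge} : e ∈ X .alice ∪ X .bob ↔ ∃ p, e ∈ X p :=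
  ⟨fun h => h.elim (fun h => ⟨_, h⟩) fun h => ⟨_, h⟩, fun ⟨p, h⟩ => by
    cases p
    exacts [Or.inl h, Or.inr h]⟩

theorem IsCorrectLeaf.take_mem (hv : IsCorrectLeaf T X v) (hX : ∀ p, IsInput T p (X p)) {p : Party}
    {k : ℕ} (h1 : 1 ≤ k) (hT : k ≤ T) (hp : (k + 1) % 2 = p.parity) : v.take k ∈ X p := by
  have hk : (v.take k).length = k := by rw [List.length_take, hv.1]; omega
  obtain ⟨q, hq⟩ := mem_union_inputs.1
    (hv.2 (v.take k) (by rw [← List.length_pos_iff]; omega) (List.take_prefix _ _))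
  have := (hX q).length_mod hq
  rw [hk] at this
  rcases p.eq_or_eq_other q with rfl | rfl
  · exact hq
  · have := p.parity_other
    have := p.parity_lt_two
    omega

/-- Every vertex has only one outgoing input edge, so a path from the root cannot leave the one to
`v`. -/
theorem IsCorrectLeaf.prefix_of_isPathIn (hv : IsCorrectLeaf T X v) (hX : ∀ p, IsInput T p (X p))
    {w : List Bool} (hw : IsPathIn (X .alice ∪ X .bob) w) : w <+: v := by
  induction w using List.reverseRecOn with
  | nil => exact List.nil_prefix
  | append_singleton w b ih =>
    have h1 := ih (hw.of_prefix (List.prefix_append _ _))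
    obtain ⟨p, hp⟩ := mem_union_inputs.1 (hw (w ++ [b]) (by simp) List.prefix_rfl)
    have hl := (hX p).length_mod hp
    simp only [List.length_append, List.length_singleton] at hl
    have h2 := hv.take_mem hX hl.1 hl.2.1 hl.2.2
    obtain ⟨t, rfl⟩ := h1
    have ht := hv.1
    rw [List.length_append] at ht
    obtain ⟨c, t, rfl⟩ := List.exists_cons_of_ne_nil (l := t) (by rintro rfl; simp at ht; omega)
    have h3 : (w ++ c :: t).take (w.length + 1) = w ++ [c] := by
      rw [List.take_length_add_append]; simp
    rw [h3] at h2
    obtain ⟨d, -, hd⟩ := (hX p).2 w (by omega) (by omega)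
    rw [hd b hp, ← hd c h2]
    exact ⟨t, by simp⟩

theorem exists_isCorrectLeaf (hX : ∀ p, IsInput T p (X p)) : ∃ v, IsCorrectLeaf T X v := by
  have key : ∀ k ≤ T, ∃ v : List Bool, v.length = k ∧ IsPathIn (X .alice ∪ X .bob) v := by
    intro k
    induction k with
    | zero => exact fun _ => ⟨[], rfl, fun e h0 he => absurd (List.prefix_nil.1 he) h0⟩
    | succ k ih =>
      intro hk
      obtain ⟨v, hv, hp⟩ := ih (by omega)
      obtain ⟨p, hpar⟩ : ∃ p : Party, v.length % 2 = p.parity := by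
        rcases Nat.mod_two_eq_zero_or_one v.length with h | h
        exacts [⟨.alice, h⟩, ⟨.bob, h⟩]
      obtain ⟨b, hb, -⟩ := (hX p).2 v (by omega) hpar
      refine ⟨v ++ [b], by simp [hv], fun e h0 he => ?_⟩
      rcases List.prefix_concat_iff.1 he with rfl | he
      · exact mem_union_inputs.2 ⟨p, hb⟩
      · exact hp e h0 he
  exact key T le_rfl

theorem uniquePath_eq {S : Set Edge} {w : List Bool} (h : IsUniquePathIn S w) :
    uniquePath S = some w := by
  have hex : ∃ v, IsUniquePathIn S v := ⟨w, h⟩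
  rw [uniquePath, dif_pos hex]
  have h' := hex.choose_spec
  have h1 := h.2 _ h'.1
  exact congrArg some (h1.eq_of_length_le (h'.2 _ h.1).length_le)

end Path

/-! ### The next announcement -/

section NextEdge

theorem nextEdge_concat (X : Set Edge) (l : List (Option Edge)) (w : List Bool) (b : Bool)
    [Decidable (MayAnnounce X l (w ++ [b]))] : nextEdge X l (w ++ [b]) =
      if MayAnnounce X l (w ++ [b]) then some (w ++ [b]) else nextEdge X l w := by
  simp only [nextEdge, List.inits_append]
  simp [List.find?_cons]
  split_ifs <;> simp_all

theorem mayAnnounce_of_nextEdge {X : Set Edge} {l : List (Option Edge)} {w : List Bool} {e : Edge}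
    (h : nextEdge X l w = some e) : e <+: w ∧ MayAnnounce X l e := by
  rw [nextEdge] at h
  have h1 := List.find?_some h
  have h2 := List.mem_of_find?_eq_some h
  rw [List.mem_reverse, List.mem_inits] at h2
  exact ⟨h2, by simpa using h1⟩

theorem nextEdge_eq_some {X : Set Edge} {l : List (Option Edge)} {w : List Bool} {e : Edge}
    (hw : e <+: w) (he : MayAnnounce X l e)
    (hmax : ∀ e', e' <+: w → MayAnnounce X l e' → e'.length ≤ e.length) :
    nextEdge X l w = some e := by
  classical
  induction w using List.reverseRecOn with
  | nil => exact absurd (List.prefix_nil.1 hw) he.1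
  | append_singleton w b ih =>
    rw [nextEdge_concat]
    split_ifs with h
    · rw [(hw.eq_of_length_le (hmax _ List.prefix_rfl h))]
    · rcases List.prefix_concat_iff.1 hw with rfl | hw
      · exact absurd he h
      · exact ih hw fun e' h' => hmax e' (h'.trans (List.prefix_append _ _))

end NextEdge

/-! ### Encoding and decoding of announcements -/

section Symbols

variable {Γ : Type} {T N : ℕ} {C : PrefixCode (Sym N) Γ}

theorem bit₁_ofBits (a b : Bool) : bit₁ (ofBits a b) = a := by cases a <;> cases b <;> rfl

theorem bit₂_ofBits (a b : Bool) : bit₂ (ofBits a b) = b := by cases a <;> cases b <;> rfl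

theorem decodeSym_symbolOf (ch : Choices T N C) {p : Party} {X : Set Edge} (hX : IsInput T p X)
    {l : List (Option Edge)} (hl : l.length < N) {eo : Option Edge}
    (he : ∀ e, eo = some e → MayAnnounce X l e) :
    decodeSym T N p l (symbolOf ch l eo) = some eo := by
  cases eo with
  | none => simp [decodeSym, symbolOf]
  | some e =>
    obtain ⟨-, heX, hgp⟩ := he e rfl
    obtain ⟨h1, hT, hp⟩ := hX.length_mod heX
    by_cases h2 : e.length ≤ 2
    · have hval : (symbolOf ch l (some e)).1.val = 0 := by simp [symbolOf, h2]
      have hval2 : (symbolOf ch l (some e)).2 = grandIndex e := rfl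
      have hN : ¬ 0 = N := by omega
      rw [decodeSym.eq_def, hval, hval2]
      simp only [hN, if_false, if_true]
      match e, h1, h2 with
      | [b], _, _ =>
        cases p
        · simp [grandIndex, bit₁_ofBits, bit₂_ofBits]; simp at hT; omega
        · simp [Party.parity] at hp
      | [a, b], _, _ =>
        cases p
        · simp [Party.parity] at hp
        · simp [grandIndex, bit₁_ofBits, bit₂_ofBits]; simp at hT; omega
    · obtain ⟨hr1, hr2⟩ := ch.ref_spec l _ (hgp.resolve_left h2)
      -- The cited round is at most `l.length < N`. It is therefore not reduced modulo `N + 1`, and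
      -- it is not `N`, the code of the empty edge.
      have hr3 : ch.ref l (grandparent e) - 1 < l.length := (List.getElem?_eq_some_iff.1 hr2).1
      have hval : (symbolOf ch l (some e)).1.val = ch.ref l (grandparent e) := by
        simp only [symbolOf, h2, if_false, Fin.ofNat_eq_cast, Fin.val_natCast]
        exact Nat.mod_eq_of_lt (by omega)
      have hval2 : (symbolOf ch l (some e)).2 = grandIndex e := rfl
      rw [decodeSym.eq_def]
      simp only []
      rw [hval, hval2, if_neg (by omega), if_neg (by omega), hr2]
      have hgl : (grandparent e).length = e.length - 2 := by simp [grandparent]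
      have hee : grandparent e ++ e.drop (e.length - 2) = e := List.take_append_drop _ _
      obtain ⟨a, b, hab⟩ : ∃ a b, e.drop (e.length - 2) = [a, b] :=
        List.length_eq_two.1 (by simp; omega)
      have hidx : grandIndex e = ofBits a b := by
        rw [← hee, hab]; simp [grandIndex]
      rw [hab] at hee
      simp only [hidx, bit₁_ofBits, bit₂_ofBits, hee, hT, if_true]

theorem decodeWord_concat (p : Party) (d : List (Sym N)) (σ : Sym N) :
    decodeWord T N p (d ++ [σ]) = (decodeWord T N p d).bind fun acc =>
      (decodeSym T N p acc σ).map fun e => acc ++ [e] := by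
  simp [decodeWord, List.foldlM_append]

theorem edgeSet_eq {p : Party} {d : List (Sym N)} {l : List (Option Edge)}
    (h : decodeWord T N p d = some l) : edgeSet T N p d = {e | some e ∈ l} := by
  simp [edgeSet, h]

end Symbols

/-! ### One round of a party -/

section Round

variable {Γ : Type} {T N : ℕ} {C : PrefixCode (Sym N) Γ} {X : Party → Set Edge} {v : List Bool}

/-- The edges on the correct path that the party has announced are those of its levels below
`r`. -/
def Reach (T : ℕ) (p : Party) (v : List Bool) (l : List (Option Edge)) (r : ℕ) : Prop :=
  r % 2 = p.parity ∧ r ≤ T + 1 ∧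
    ∀ k, 1 ≤ k → k ≤ T → (k + 1) % 2 = p.parity → (some (v.take k) ∈ l ↔ k < r)

/-- The announcements of a party are consistent, and reach the depth `r` on the correct path. -/
structure Announcing (T N : ℕ) (p : Party) (X : Set Edge) (v : List Bool) (st : PartyState N Γ)
    (r : ℕ) : Prop where
  decode : decodeWord T N p st.sent = some st.announced
  length_eq : st.announced.length = st.sent.length
  mem : ∀ e, some e ∈ st.announced → e ∈ X
  reach : Reach T p v st.announced r

/-- An edge beyond level 2 needs its grandparent announced, so announcements along the correct path
cannot skip a level of the party. Hence only the edge at level `r + 1` can be new. -/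
theorem MayAnnounce.level_le (hv : IsCorrectLeaf T X v) (hX : ∀ p, IsInput T p (X p)) {p : Party}
    {l : List (Option Edge)} {r k : ℕ} (hr : Reach T p v l r) (hk : k ≤ T)
    (he : MayAnnounce (X p) l (v.take k)) : 1 ≤ k ∧ (k + 1) % 2 = p.parity ∧ k ≤ r + 1 := by
  have hkl : (v.take k).length = k := by rw [List.length_take, hv.1]; omega
  obtain ⟨-, h1, h2⟩ := he
  have h3 := (hX p).length_mod h1
  rw [hkl] at h3 h2
  refine ⟨h3.1, h3.2.2, ?_⟩
  have := hr.1
  by_cases hk2 : k ≤ 2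
  · omega
  · have h4 := h2.resolve_left hk2
    rw [grandparent, hkl, List.take_take, min_eq_left (by omega)] at h4
    have := (hr.2.2 (k - 2) (by omega) (by omega) (by omega)).1 h4
    omega

theorem mayAnnounce_take (hv : IsCorrectLeaf T X v) (hX : ∀ p, IsInput T p (X p)) {p : Party}
    {l : List (Option Edge)} {r : ℕ} (hr : Reach T p v l r) (hT : r < T) :
    MayAnnounce (X p) l (v.take (r + 1)) := by
  have hkl : (v.take (r + 1)).length = r + 1 := by rw [List.length_take, hv.1]; omega
  have hpar := hr.1
  have := p.parity_lt_two
  refine ⟨by rw [← List.length_pos_iff]; omega,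
    hv.take_mem hX (by omega) (by omega) (by omega), ?_⟩
  rw [hkl, or_iff_not_imp_left]
  intro h2
  rw [grandparent, hkl, List.take_take, min_eq_left (by omega)]
  exact (hr.2.2 _ (by omega) (by omega) (by omega)).2 (by omega)

theorem Reach.concat (hv : IsCorrectLeaf T X v) (hX : ∀ p, IsInput T p (X p)) {p : Party}
    {l : List (Option Edge)} {r : ℕ} (hr : Reach T p v l r) {eo : Option Edge}
    (he : ∀ e, eo = some e → MayAnnounce (X p) l e) :
    ∃ r', (r' = r ∨ r' = r + 2) ∧ (eo = some (v.take (r + 1)) → r < T → r' = r + 2) ∧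
      Reach T p v (l ++ [eo]) r' := by
  have hpar := hr.1
  have hlen : ∀ k, k ≤ T → (v.take k).length = k := fun k hk => by
    rw [List.length_take, hv.1]; omega
  by_cases h : eo = some (v.take (r + 1)) ∧ r < T
  · refine ⟨r + 2, Or.inr rfl, fun _ _ => rfl, by omega, by omega, fun k h1 hT hk => ?_⟩
    rw [List.mem_append, hr.2.2 k h1 hT hk, List.mem_singleton, h.1, Option.some_inj]
    constructor
    · rintro (h' | h')
      · omega
      · have := congrArg List.length h'
        rw [hlen k hT, hlen _ (by omega)] at this
        omega
    · intro h'
      rcases Nat.lt_or_ge k r with h2 | h2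
      · exact Or.inl h2
      · obtain rfl : k = r + 1 := by omega
        exact Or.inr rfl
  · refine ⟨r, Or.inl rfl, fun h1 h2 => absurd ⟨h1, h2⟩ h, hr.1, hr.2.1, fun k h1 hT hk => ?_⟩
    rw [List.mem_append, hr.2.2 k h1 hT hk, List.mem_singleton]
    refine ⟨fun h' => h'.elim id fun h' => ?_, Or.inl⟩
    have h3 := (he _ h'.symm).level_le hv hX hr hT
    have h4 : k ≠ r + 1 := fun h4 => h ⟨by rw [← h', h4], by omega⟩
    omega

/-- This holds whatever was decoded: a wrong decoding may waste the round, but the announcement is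
still an edge of the party's own input with a valid reference. -/
theorem Announcing.round {p : Party} {st : PartyState N Γ} {r : ℕ} (hv : IsCorrectLeaf T X v)
    (hX : ∀ p, IsInput T p (X p)) (h : Announcing T N p (X p) v st r) (ch : Choices T N C) (R : ℕ)
    (hN : st.sent.length < N) :
    ∃ r', (r' = r ∨ r' = r + 2) ∧
      ((uniquePath (edgeSet T N p.other (ch.dec st.recv) ∪ X p)).bind
        (nextEdge (X p) st.announced) = some (v.take (r + 1)) → r < T → r' = r + 2) ∧
      Announcing T N p (X p) v (EditPJP.round ch R p (X p) st) r' := by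
  have he : ∀ e, (uniquePath (edgeSet T N p.other (ch.dec st.recv) ∪ X p)).bind
      (nextEdge (X p) st.announced) = some e → MayAnnounce (X p) st.announced e := by
    intro e he
    obtain ⟨w, -, hw⟩ := Option.bind_eq_some_iff.1 he
    exact (mayAnnounce_of_nextEdge hw).2
  obtain ⟨r', h1, h2, h3⟩ := h.reach.concat hv hX he
  refine ⟨r', h1, h2, ?_, ?_, ?_, h3⟩
  · simp only [EditPJP.round]
    rw [decodeWord_concat, h.decode, Option.bind_some,
      decodeSym_symbolOf ch (hX p) (by rw [h.length_eq]; exact hN) he, Option.map_some]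
  · simp [EditPJP.round, h.length_eq]
  · intro e hmem
    simp only [EditPJP.round, List.mem_append, List.mem_singleton] at hmem
    rcases hmem with hmem | hmem
    · exact h.mem e hmem
    · exact (he e hmem.symm).2.1

/-- After a correct decoding, a party sees the correct path up to the first edge that the other
party has not announced. -/
theorem isUniquePathIn_of_announcing (hv : IsCorrectLeaf T X v) (hX : ∀ p, IsInput T p (X p))
    {p : Party} {st : PartyState N Γ} {r : ℕ}
    (h : Announcing T N p.other (X p.other) v st r) :
    IsUniquePathIn (edgeSet T N p.other st.sent ∪ X p) (v.take (min T r)) := by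
  rw [edgeSet_eq h.decode]
  have hlen : ∀ k, k ≤ T → (v.take k).length = k := fun k hk => by
    rw [List.length_take, hv.1]; omega
  have hp := p.parity_other
  have hp2 := p.parity_lt_two
  have hr := h.reach.1
  constructor
  · intro e h0 he
    have hl := he.length_le
    rw [hlen _ (min_le_left _ _)] at hl
    have hl0 := List.length_pos_iff.2 h0
    have hee : e = v.take e.length := List.prefix_iff_eq_take.1 (he.trans (List.take_prefix _ _))
    rcases (by omega : (e.length + 1) % 2 = p.parity ∨ (e.length + 1) % 2 = p.other.parity)
      with h1 | h1
    · rw [hee]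
      exact Or.inr (hv.take_mem hX hl0 (by omega) h1)
    · refine Or.inl ?_
      change some e ∈ st.announced
      rw [hee]
      exact (h.reach.2.2 _ hl0 (by omega) h1).2 (by omega)
  · intro w hw
    have hsub : {e | some e ∈ st.announced} ∪ X p ⊆ X .alice ∪ X .bob := by
      rintro e (he | he)
      · exact mem_union_inputs.2 ⟨_, h.mem e he⟩
      · exact mem_union_inputs.2 ⟨_, he⟩
    have hwv := hv.prefix_of_isPathIn hX (hw.mono hsub)
    have hwT := hwv.length_le
    rw [hv.1] at hwT
    refine List.prefix_of_prefix_length_le hwv (List.take_prefix _ _) ?_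
    rw [hlen _ (min_le_left _ _)]
    by_contra! hlt
    -- The edge at level `r + 1` belongs to the other party, which has not announced it, so no path
    -- can go through it.
    have hrT : r + 1 ≤ w.length := by omega
    have hpre : v.take (r + 1) <+: w :=
      List.prefix_of_prefix_length_le (List.take_prefix _ _) hwv (by rw [hlen _ (by omega)]; omega)
    rcases hw _ (by rw [← List.length_pos_iff, hlen _ (by omega)]; omega) hpre with h1 | h1
    · have := (h.reach.2.2 (r + 1) (by omega) (by omega) (by omega)).1 h1
      omega
    · have := (hX p).length_mod h1
      rw [hlen _ (by omega)] at this
      omega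

theorem nextEdge_take (hv : IsCorrectLeaf T X v) (hX : ∀ p, IsInput T p (X p)) {p : Party}
    {l : List (Option Edge)} {r m : ℕ} (hr : Reach T p v l r) (hm : m ≤ T) (hrm : r < m) :
    nextEdge (X p) l (v.take m) = some (v.take (r + 1)) := by
  refine nextEdge_eq_some (List.take_prefix_take_left (by omega))
    (mayAnnounce_take hv hX hr (by omega)) fun e he hme => ?_
  have hl := he.length_le
  have h1 : e = v.take e.length := List.prefix_iff_eq_take.1 (he.trans (List.take_prefix _ _))
  rw [List.length_take, hv.1] at hl
  rw [h1] at hme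
  have := (hme.level_le hv hX hr (by omega)).2.2
  rw [List.length_take, hv.1]
  omega

/-- The local invariant of a party: after `bad` wrong decodings, and `idle` correct ones that came
too early for a vote, the votes are as they should be. -/
structure Healthy (T N : ℕ) (p : Party) (X : Set Edge) (v : List Bool) (st : PartyState N Γ)
    (r bad idle : ℕ) : Prop extends Announcing T N p X v st r where
  wrong : ∀ w, w ≠ v → st.votes w ≤ bad
  right : st.sent.length ≤ st.votes v + bad + idle

/-- A wrong decoding gives at most one vote to a wrong leaf, and the increase of `bad` also covers
the missing right vote. -/
theorem Healthy.round_of_ne {p : Party} {st : PartyState N Γ} {r bad idle : ℕ}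
    (hv : IsCorrectLeaf T X v) (hX : ∀ p, IsInput T p (X p))
    (h : Healthy T N p (X p) v st r bad idle) (ch : Choices T N C) (R : ℕ)
    (hN : st.sent.length < N) : ∃ r', r ≤ r' ∧
      Healthy T N p (X p) v (EditPJP.round ch R p (X p) st) r' (bad + 1) idle := by
  obtain ⟨r', h1, -, h3⟩ := h.toAnnouncing.round hv hX ch R hN
  refine ⟨r', by omega, h3, fun w hw => ?_, ?_⟩
  · have := h.wrong w hw
    simp only [EditPJP.round]
    split_ifs <;> omega
  · have := h.right
    simp only [EditPJP.round, List.length_append, List.length_singleton]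
    split_ifs <;> omega

theorem Healthy.round_of_eq {p : Party} {st st' : PartyState N Γ} {r r₂ bad idle : ℕ}
    (hv : IsCorrectLeaf T X v) (hX : ∀ p, IsInput T p (X p))
    (h : Healthy T N p (X p) v st r bad idle)
    (h' : Announcing T N p.other (X p.other) v st' r₂) (ch : Choices T N C) (R : ℕ)
    (hN : st.sent.length < N) (hdec : ch.dec st.recv = st'.sent) :
    ∃ r', r ≤ r' ∧ (r < r₂ → r < T → r' = r + 2) ∧ Healthy T N p (X p) v
      (EditPJP.round ch R p (X p) st) r' bad (if r₂ < T then idle + 1 else idle) := by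
  have hpath := uniquePath_eq (isUniquePathIn_of_announcing hv hX h')
  obtain ⟨r', h1, h2, h3⟩ := h.toAnnouncing.round hv hX ch R hN
  refine ⟨r', by omega, fun hr hT => h2 ?_ hT, h3, fun w hw => ?_, ?_⟩
  · rw [hdec, hpath, Option.bind_some]
    exact nextEdge_take hv hX h.reach (min_le_left _ _) (by omega)
  · have := h.wrong w hw
    simp only [EditPJP.round]
    rw [if_neg]
    · exact this
    · rintro ⟨hwT, hw'⟩
      rw [hdec, hpath, Option.some_inj] at hw'
      have hpre : w <+: v := hw' ▸ List.take_prefix _ _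
      exact hw (hpre.eq_of_length (by rw [hwT, hv.1]))
  · have := h.right
    simp only [EditPJP.round, List.length_append, List.length_singleton]
    split_ifs with ha hb hb
    · omega
    · omega
    · omega
    · refine absurd ⟨hv.1, ?_⟩ ha
      rw [hdec, hpath, min_eq_left (by omega), ← hv.1, List.take_length]

end Round

/-! ### The invariant of an execution -/

section Execution

variable {Γ : Type} {T N : ℕ} {C : PrefixCode (Sym N) Γ} {X : Party → Set Edge} {v : List Bool}

/-- The correct decodings of a party that came too early for a vote are paid for by the progress on
the correct path, the bad decodings of the other party and the spoofed replies. -/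
def Settled (r r₂ idle bad₂ oos : ℕ) : Prop := 2 * idle + 1 ≤ min r₂ (r + 1) + 2 * (bad₂ + oos)

/-- The party has just decoded correctly, and the next edge of the correct path belongs to
the other party. -/
def Waiting (T r r₂ idle bad₂ oos : ℕ) : Prop :=
  r₂ < r ∧ r₂ < T ∧ 2 * idle ≤ r₂ + 1 + 2 * (bad₂ + oos)

theorem idle_le {T r r₂ idle bad₂ oos : ℕ} (hr : r₂ ≤ T + 1)
    (h : Settled r r₂ idle bad₂ oos ∨ Waiting T r r₂ idle bad₂ oos) :
    2 * idle ≤ T + 2 * (bad₂ + oos) := by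
  rcases h with h | ⟨-, h1, h2⟩
  · unfold Settled at h; omega
  · omega

theorem Healthy.receive {p : Party} {st : PartyState N Γ} {r bad idle : ℕ}
    (h : Healthy T N p (X p) v st r bad idle) (w : List Γ) :
    Healthy T N p (X p) v { st with recv := w } r bad idle :=
  ⟨⟨h.decode, h.length_eq, h.mem, h.reach⟩, h.wrong, h.right⟩

theorem healthy_empty (p : Party) :
    Healthy T N p (X p) v ({} : PartyState N Γ) p.parity 0 0 := by
  have := p.parity_lt_two
  refine ⟨⟨rfl, rfl, by simp, Nat.mod_eq_of_lt this, by omega, fun k h1 hT hk => ?_⟩, by simp,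
    by simp⟩
  simp
  omega

/-- In round `R` the correct leaf has at least `R - bad - idle` votes and any other at most `bad`,
so `2 * bad + idle < R` decides the vote. Later rounds leave the output unchanged. -/
theorem Healthy.output_round {p : Party} {st : PartyState N Γ} {r bad idle : ℕ}
    {ch : Choices T N C} {R : ℕ} (hv : v.length = T)
    (h : Healthy T N p (X p) v (round ch R p (X p) st) r bad idle) (hR : 2 * bad + idle < R)
    (hout : R ≤ st.rounds → st.output = some v)
    (hle : R ≤ (round ch R p (X p) st).rounds) : (round ch R p (X p) st).output = some v := by
  have hlen : (round ch R p (X p) st).sent.length = st.rounds + 1 := by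
    simp [round, PartyState.rounds]
  by_cases hR' : st.rounds + 1 = R
  · have h1 : (round ch R p (X p) st).output =
        some (ch.pick (round ch R p (X p) st).votes) := by
      simp only [round]
      rw [if_pos hR']
    rw [h1, Option.some_inj]
    by_contra hne
    have h2 := ch.pick_max (round ch R p (X p) st).votes v hv
    have h3 := h.wrong _ hne
    have h4 := h.right
    omega
  · have h1 : (round ch R p (X p) st).output = st.output := by
      simp only [round]
      rw [if_neg hR']
    rw [h1]
    refine hout ?_
    rw [PartyState.rounds, hlen] at hle
    omega

/-- The effect of one round, in which `p` has received the symbol of the newest column. -/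
theorem Healthy.exists_round {p : Party} {st st₂ : PartyState N Γ} {r r₂ bad bad₂ idle idle₂ oos
    oos₂ : ℕ} (hv : IsCorrectLeaf T X v) (hX : ∀ p, IsInput T p (X p)) {ε β : ℝ}
    (hε : 0 < ε) (hε' : ε ≤ 1 / 18) (hβ : β < 1 - 2 * ε) (hC : IsEditTreeCode (1 - ε) N C)
    (ch : Choices T N C) (R : ℕ)
    (h : Healthy T N p (X p) v st r bad idle)
    (h₂ : Healthy T N p.other (X p.other) v st₂ r₂ bad₂ idle₂)
    {c : Option Γ × Option Γ} {τ : Columns Γ} (hc : c.2.isSome)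
    (hM : IsMatching (c :: τ).reverse (encode C st₂.sent) st.recv) (hbad : bad ≤ badCount β τ)
    (hN : st.sent.length < N) (hN₂ : st₂.sent.length ≤ N) (hs : Settled r r₂ idle bad₂ oos)
    (hs₂ : Settled r₂ r idle₂ bad oos₂ ∨ Waiting T r₂ r idle₂ bad oos₂) :
    ∃ r' bad' idle', Healthy T N p (X p) v (round ch R p (X p) st) r' bad' idle' ∧
      bad' ≤ badCount β (c :: τ) ∧
      (Settled r' r₂ idle' bad₂ oos ∨ Waiting T r' r₂ idle' bad₂ oos) ∧
      Settled r₂ r' idle₂ bad' oos₂ := by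
  unfold Settled at hs
  by_cases hdec : ch.dec st.recv = st₂.sent
  · obtain ⟨r', h1, h2, h3⟩ := h.round_of_eq hv hX h₂.toAnnouncing ch R hN hdec
    refine ⟨r', bad, _, h3, hbad.trans (badCount_le_cons _ _ _), ?_, ?_⟩
    · have e1 := h3.reach.1
      have e2 := h₂.reach.1
      have e3 := p.parity_other
      have e4 := p.parity_lt_two
      unfold Settled Waiting
      by_cases hT : r₂ < T
      · rw [if_pos hT]
        -- A new idle round either leaves the party ahead, waiting for the other party's edge, or
        -- the party was behind and its own reach grows by 2, which pays for the round.
        by_cases hlt : r₂ < r'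
        · exact Or.inr ⟨hlt, hT, by omega⟩
        · have := h2 (by omega) (by omega)
          exact Or.inl (by omega)
      · rw [if_neg hT]
        exact Or.inl (by omega)
    · unfold Settled Waiting at *
      -- If the other party was waiting for `p`, the correct decoding makes `p` announce that edge,
      -- and the gain of 2 settles the debt.
      rcases hs₂ with hs₂ | ⟨g1, g2, g3⟩
      · omega
      · have := h2 g1 g2
        omega
  · obtain ⟨r', h1, h3⟩ := h.round_of_ne hv hX ch R hN
    refine ⟨r', bad + 1, idle, h3, ?_, Or.inl (by unfold Settled; omega), ?_⟩
    · rw [badCount, if_pos]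
      · omega
      · exact ⟨hc, fun hb => hdec (ch.dec_eq hε hε' hβ hC hM hb hN₂)⟩
    · unfold Settled Waiting at *
      omega

/-- The string matchings between the symbols sent and received, and the numbers of corruptions: `M p`
is for the symbols sent by `p`, `sub p` counts the substitutions received by `p`, and `oos p` the
spoofed replies to `p`. -/
structure Accounting (K : ℕ) (M : Party → Columns Γ) (sub oos : Party → ℕ) : Prop where
  inserted : ∀ p, blanks₁ (M p) = sub p.other + oos p.other
  deleted : ∀ p, blanks₂ (M p) = sub p.other + oos p
  total : sub .alice + sub .bob + (oos .alice + oos .bob) = K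

/-- Apply `badCount_le` to both directions, that of the symbols received by `p` with weight 2. A
substitution then has weight 8 or 4, according to its receiver. A spoofed reply to `p` has weight `6
+ 2β ≤ 8`, including the term `oos p`, and one to the other party weight `6 - β`. -/
theorem Accounting.bad_le {K : ℕ} {M : Party → Columns Γ} {sub oos : Party → ℕ}
    (h : Accounting K M sub oos) {β : ℝ} (h0 : 0 ≤ β) (h1 : β ≤ 1) {p : Party} {bad bad₂ : ℕ}
    (hb : bad ≤ badCount β (M p.other)) (hb₂ : bad₂ ≤ badCount β (M p)) :
    β * (2 * bad + bad₂ + oos p) ≤ 8 * K := by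
  have e1 := badCount_le h0 (by linarith) (M p.other)
  have e2 := badCount_le h0 (by linarith) (M p)
  have i1 := h.inserted p.other
  have i2 := h.inserted p
  have d1 := h.deleted p.other
  have d2 := h.deleted p
  rw [Party.other_other] at i1 d1
  rw [i1, d1] at e1
  rw [i2, d2] at e2
  have ht : (sub p + sub p.other + (oos p + oos p.other) : ℝ) = K := by
    have : sub p + sub p.other + (oos p + oos p.other) = K := by
      rw [← h.total]
      cases p
      · simp only [Party.other]
      · simp only [Party.other]; ring
    exact_mod_cast this
  have b1 : β * bad ≤ β * badCount β (M p.other) :=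
    mul_le_mul_of_nonneg_left (by exact_mod_cast hb) h0
  have b2 : β * bad₂ ≤ β * badCount β (M p) :=
    mul_le_mul_of_nonneg_left (by exact_mod_cast hb₂) h0
  push_cast at e1 e2
  have p1 : (0 : ℝ) ≤ oos p := by positivity
  have p2 : (0 : ℝ) ≤ oos p.other := by positivity
  have p3 : (0 : ℝ) ≤ sub p.other := by positivity
  have p4 : β * oos p ≤ oos p := by nlinarith
  have p5 : 0 ≤ β * oos p.other := by positivity
  nlinarith

/-- The invariant of an execution after `t` events, `K` of them corruptions, while a symbol of the
party `s` is in transit: `r p`, `bad p` and `idle p` are as in `Healthy`, and `M`, `sub` and `oos` as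
in `Accounting`, where the symbol in transit is not yet in `M s`. -/
structure Invariant (C : PrefixCode (Sym N) Γ) (T : ℕ) (X : Party → Set Edge) (v : List Bool)
    (β : ℝ) (R K t : ℕ) (st : State N Γ) (s : Party) (M : Party → Columns Γ)
    (r bad idle sub oos : Party → ℕ) : Prop where
  sender : st.sender = some s
  rounds_le : ∀ p, (st.party p).rounds ≤ N
  rounds_add : (st.party .alice).rounds + (st.party .bob).rounds = t + 1
  sync_alice : (st.party .alice).rounds ≤
    (st.party .bob).rounds + (oos .alice + oos .bob) + (1 - s.parity)
  sync_bob : (st.party .bob).rounds + (1 - s.parity) ≤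
    (st.party .alice).rounds + (oos .alice + oos .bob)
  healthy : ∀ p, Healthy T N p (X p) v (st.party p) (r p) (bad p) (idle p)
  sent_ne : (st.party s).sent ≠ []
  matching_sender : IsMatching (M s).reverse (encode C (st.party s).sent.dropLast)
    (st.party s.other).recv
  matching_other : IsMatching (M s.other).reverse (encode C (st.party s.other).sent)
    (st.party s).recv
  bad_le : ∀ p, bad p ≤ badCount β (M p.other)
  accounting : Accounting K M sub oos
  settled_sender : Settled (r s) (r s.other) (idle s) (bad s.other) (oos s) ∨
    Waiting T (r s) (r s.other) (idle s) (bad s.other) (oos s)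
  settled_other : Settled (r s.other) (r s) (idle s.other) (bad s) (oos s.other)
  output : ∀ p, R ≤ (st.party p).rounds → (st.party p).output = some v

/-- What the analysis needs of the parameters: with at most `B` corruptions, the votes for the
correct leaf prevail in round `R`, and both parties reach their round `R`. -/
structure Parameters (T N R : ℕ) (ε β B : ℝ) : Prop where
  pos : 0 < ε
  le : ε ≤ 1 / 18
  nonneg : 0 ≤ β
  lt : β < 1 - 2 * ε
  votes : ∀ b b' o u : ℕ, β * (2 * b + b' + o) ≤ 8 * B → 2 * u ≤ T + 2 * (b' + o) → 2 * b + u < R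
  rounds : ∀ k : ℕ, (k : ℝ) ≤ B → R + k ≤ N

/-- A party receives a symbol and carries out a round. -/
theorem exists_invariant_receive {ε β B : ℝ} {R K t : ℕ} (hpar : Parameters T N R ε β B)
    (hK : (K : ℝ) ≤ B) (hv : IsCorrectLeaf T X v) (hX : ∀ p, IsInput T p (X p))
    (hC : IsEditTreeCode (1 - ε) N C) (ch : Party → Choices T N C) {st : State N Γ} {p : Party}
    {σ : Γ} {M : Party → Columns Γ} {r bad idle sub oos : Party → ℕ}
    (hN : (st.party p).rounds < N) (hN₂ : (st.party p.other).rounds ≤ N)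
    (hadd : (st.party .alice).rounds + (st.party .bob).rounds = t)
    (hsa : (st.party .alice).rounds ≤
      (st.party .bob).rounds + (oos .alice + oos .bob) + p.parity)
    (hsb : (st.party .bob).rounds + p.parity ≤ (st.party .alice).rounds + (oos .alice + oos .bob))
    (hh : ∀ p, Healthy T N p (X p) v (st.party p) (r p) (bad p) (idle p))
    (hMp : IsMatching (M p).reverse (encode C (st.party p).sent) (st.party p.other).recv)
    (hMq : IsMatching (M p.other).reverse (encode C (st.party p.other).sent)
      ((st.party p).recv ++ [σ]))
    {c : Option Γ × Option Γ} {τ : Columns Γ} (hc : c.2.isSome) (hM : M p.other = c :: τ)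
    (hbp : bad p ≤ badCount β τ) (hbq : bad p.other ≤ badCount β (M p))
    (hacc : Accounting K M sub oos)
    (hsp : Settled (r p) (r p.other) (idle p) (bad p.other) (oos p))
    (hsq : Settled (r p.other) (r p) (idle p.other) (bad p) (oos p.other) ∨
      Waiting T (r p.other) (r p) (idle p.other) (bad p) (oos p.other))
    (hout : ∀ p, R ≤ (st.party p).rounds → (st.party p).output = some v) :
    ∃ s M r bad idle sub oos,
      Invariant C T X v β R K t (receive ch R X st p σ) s M r bad idle sub oos := by
  have hne := p.other_ne
  obtain ⟨r', bad', idle', g1, g2, g3, g4⟩ := Healthy.exists_round hv hX hpar.pos hpar.le hpar.lt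
    hC (ch p) R ((hh p).receive ((st.party p).recv ++ [σ])) (hh p.other) hc (hM ▸ hMq) hbp hN hN₂
    hsp hsq
  set st' := round (ch p) R p (X p) { st.party p with recv := (st.party p).recv ++ [σ] } with hst'
  have hrec : receive ch R X st p σ =
      { party := Function.update st.party p st', sender := some p } := by
    simp only [receive]
    rw [if_pos hN]
  have hpar' : ∀ q, q ≠ p → q = p.other := fun q hq => (p.eq_or_eq_other q).resolve_left hq
  have hrounds : st'.rounds = (st.party p).rounds + 1 := by
    simp [hst', round, PartyState.rounds]
  have hvotes : 2 * bad' + idle' < R := by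
    refine hpar.votes bad' (bad p.other) (oos p) idle' ?_ (idle_le (hh p.other).reach.2.1 g3)
    refine (hacc.bad_le hpar.nonneg (by linarith [hpar.lt, hpar.pos]) (hM ▸ g2) hbq).trans ?_
    linarith
  rw [hrec]
  refine ⟨p, M, Function.update r p r', Function.update bad p bad', Function.update idle p idle',
    sub, oos, rfl, ?_, ?_, ?_, ?_, ?_, ?_, ?_, ?_, ?_, hacc, ?_, ?_, ?_⟩
  · intro q
    by_cases hq : q = p
    · subst hq; simp only [Function.update_self]; omega
    · obtain rfl := hpar' q hq
      simpa only [Function.update_of_ne hq] using hN₂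
  · cases p <;> simp [Function.update] <;> omega
  · cases p <;> simp [Function.update, Party.parity] at * <;> omega
  · cases p <;> simp [Function.update, Party.parity] at * <;> omega
  · intro q
    by_cases hq : q = p
    · subst hq; simpa only [Function.update_self] using g1
    · simpa only [Function.update_of_ne hq] using hh q
  · simp [hst', round]
  · simp only [Function.update_self, Function.update_of_ne hne]
    simpa [hst', round] using hMp
  · simp only [Function.update_self, Function.update_of_ne hne]
    simpa [hst', round] using hMq
  · intro q
    by_cases hq : q = p
    · subst hq; rw [Function.update_self, hM]; exact g2
    · obtain rfl := hpar' q hq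
      rw [Function.update_of_ne hq, Party.other_other]; exact hbq
  · simpa only [Function.update_self, Function.update_of_ne hne] using g3
  · simpa only [Function.update_self, Function.update_of_ne hne] using g4
  · intro q
    by_cases hq : q = p
    · subst hq
      simp only [Function.update_self]
      exact g1.output_round hv.1 hvotes (hout q)
    · simpa only [Function.update_of_ne hq] using hout q

/-- The execution has ended as it should. -/
structure Finished (R : ℕ) (v : List Bool) (st : State N Γ) : Prop where
  sender : st.sender = none
  rounds : ∀ p, R ≤ (st.party p).rounds
  output : ∀ p, (st.party p).output = some v

theorem finished_receive {R : ℕ} {ch : Party → Choices T N C} {st : State N Γ} {p : Party} {σ : Γ}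
    (hN : N ≤ (st.party p).rounds) (hR : ∀ p, R ≤ (st.party p).rounds)
    (hout : ∀ p, R ≤ (st.party p).rounds → (st.party p).output = some v) :
    Finished R v (receive ch R X st p σ) := by
  have : receive ch R X st p σ = { st with sender := none } := by
    simp only [receive]
    rw [if_neg (by omega)]
  rw [this]
  exact ⟨rfl, hR, fun p => hout p (hR p)⟩

theorem Invariant.exists_step {ε β B : ℝ} {R K t : ℕ} (hpar : Parameters T N R ε β B)
    (hv : IsCorrectLeaf T X v) (hX : ∀ p, IsInput T p (X p))
    (hC : IsEditTreeCode (1 - ε) N C) (ch : Party → Choices T N C) {st : State N Γ} {s : Party}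
    {M : Party → Columns Γ} {r bad idle sub oos : Party → ℕ}
    (h : Invariant C T X v β R K t st s M r bad idle sub oos) (ev : Event Γ)
    (hK : ((K + if ev.isCorruption then 1 else 0 : ℕ) : ℝ) ≤ B) :
    (∃ s M r bad idle sub oos, Invariant C T X v β R (K + if ev.isCorruption then 1 else 0)
      (t + 1) (step ch R X st ev) s M r bad idle sub oos) ∨ Finished R v (step ch R X st ev) := by
  have hne := s.other_ne
  have hR := hpar.rounds _ hK
  have htot := h.accounting.total
  have hsa := h.sync_alice
  have hsb := h.sync_bob
  have hoo := s.other_other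
  have hsent : encode C (st.party s).sent =
      encode C (st.party s).sent.dropLast ++ [C (st.party s).sent] := by
    conv_lhs => rw [← List.dropLast_append_getLast h.sent_ne]
    rw [encode_concat, List.dropLast_append_getLast h.sent_ne]
  have hall : ∀ p : Party, N ≤ (st.party p).rounds → R ≤ (st.party p.other).rounds →
      ∀ p, R ≤ (st.party p).rounds := by
    intro p h1 h2 q
    rcases p.eq_or_eq_other q with rfl | rfl
    · omega
    · exact h2
  have hpart : ∀ {P : Party → Prop}, P s → P s.other → ∀ p, P p := by
    intro P h1 h2 p
    rcases s.eq_or_eq_other p with rfl | rfl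
    exacts [h1, h2]
  cases ev with
  | deliver =>
    have hstep : step ch R X st .deliver = receive ch R X st s.other (C (st.party s).sent) := by
      simp only [step, h.sender]
    rw [hstep]
    rcases Nat.lt_or_ge (st.party s.other).rounds N with hN | hN
    · left
      refine exists_invariant_receive hpar hK hv hX hC ch
        (M := Function.update M s ((some (C (st.party s).sent), some (C (st.party s).sent)) :: M s))
        (c := (some (C (st.party s).sent), some (C (st.party s).sent))) (τ := M s)
        (r := r) (bad := bad) (idle := idle) (sub := sub) (oos := oos)
        hN (hoo.symm ▸ h.rounds_le s) h.rounds_add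
        (by rw [Party.parity_other]; exact hsa) (by rw [Party.parity_other]; exact hsb)
        h.healthy ?_ ?_ rfl ?_ ?_ ?_ ?_ (by rw [hoo]; exact h.settled_other)
        (by rw [hoo]; exact h.settled_sender) h.output
      · rw [Function.update_of_ne hne, hoo]; exact h.matching_other
      · rw [hoo, Function.update_self, List.reverse_cons, hsent]
        exact h.matching_sender.append (by simp [IsMatching])
      · rw [hoo, Function.update_self]
      · have := h.bad_le s.other
        rwa [hoo] at this
      · rw [Function.update_of_ne hne, hoo]; exact h.bad_le s
      · refine ⟨hpart ?_ ?_, hpart ?_ ?_, by simpa [Event.isCorruption] using htot⟩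
        · simpa [blanks₁_cons] using h.accounting.inserted s
        · simpa [Function.update_of_ne hne] using h.accounting.inserted s.other
        · simpa [blanks₂_cons] using h.accounting.deleted s
        · simpa [Function.update_of_ne hne] using h.accounting.deleted s.other
    · right
      refine finished_receive hN (hall _ hN ?_) h.output
      rw [hoo]
      cases s <;> simp [Party.other, Party.parity] at * <;> omega
  | substitute σ =>
    have hstep : step ch R X st (.substitute σ) = receive ch R X st s.other σ := by
      simp only [step, h.sender]
    rw [hstep]
    rcases Nat.lt_or_ge (st.party s.other).rounds N with hN | hN
    · left
      -- The deletion column precedes the insertion column, so that the newest column carries the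
      -- received symbol, as `badCount` requires.
      refine exists_invariant_receive hpar hK hv hX hC ch
        (M := Function.update M s ((none, some σ) :: (some (C (st.party s).sent), none) :: M s))
        (c := (none, some σ)) (τ := (some (C (st.party s).sent), none) :: M s)
        (r := r) (bad := bad) (idle := idle)
        (sub := Function.update sub s.other (sub s.other + 1)) (oos := oos)
        hN (hoo.symm ▸ h.rounds_le s) h.rounds_add
        (by rw [Party.parity_other]; exact hsa) (by rw [Party.parity_other]; exact hsb)
        h.healthy ?_ ?_ rfl ?_ ?_ ?_ ?_ (by rw [hoo]; exact h.settled_other)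
        (by rw [hoo]; exact h.settled_sender) h.output
      · rw [Function.update_of_ne hne, hoo]; exact h.matching_other
      · rw [hoo, Function.update_self, List.reverse_cons, List.reverse_cons, hsent,
          List.append_assoc]
        exact h.matching_sender.append (by simp [IsMatching])
      · rw [hoo, Function.update_self]
      · have := h.bad_le s.other
        rw [hoo] at this
        exact this.trans (badCount_le_cons _ _ _)
      · rw [Function.update_of_ne hne, hoo]; exact h.bad_le s
      · refine ⟨hpart ?_ ?_, hpart ?_ ?_, ?_⟩
        · have := h.accounting.inserted s
          simp [blanks₁_cons]; omega
        · have := h.accounting.inserted s.other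
          simpa [Function.update_of_ne hne, Function.update_of_ne hne.symm, hoo] using this
        · have := h.accounting.deleted s
          simp [blanks₂_cons]; omega
        · have := h.accounting.deleted s.other
          simpa [Function.update_of_ne hne, Function.update_of_ne hne.symm, hoo] using this
        · cases s <;> simp [Function.update, Party.other, Event.isCorruption] <;> omega
    · right
      refine finished_receive hN (hall _ hN ?_) h.output
      rw [hoo]
      cases s <;> simp [Party.other, Party.parity] at * <;> omega
  | outOfSync σ =>
    have hstep : step ch R X st (.outOfSync σ) = receive ch R X st s σ := by
      simp only [step, h.sender]
    rw [hstep]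
    rcases Nat.lt_or_ge (st.party s).rounds N with hN | hN
    · left
      have hoos : Function.update oos s (oos s + 1) .alice + Function.update oos s (oos s + 1) .bob =
          oos .alice + oos .bob + 1 := by
        cases s <;> simp [Function.update] <;> omega
      -- A spoofed reply splits over the two directions: a deletion among the symbols sent by `s`
      -- and an insertion among those it receives.
      refine exists_invariant_receive hpar hK hv hX hC ch
        (M := Function.update (Function.update M s.other ((none, some σ) :: M s.other)) s
          ((some (C (st.party s).sent), none) :: M s))
        (c := (none, some σ)) (τ := M s.other)
        (r := r) (bad := bad) (idle := idle)
        (sub := sub) (oos := Function.update oos s (oos s + 1))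
        hN (h.rounds_le _) h.rounds_add ?_ ?_
        h.healthy ?_ ?_ rfl ?_ (h.bad_le s) ?_ ?_ ?_ ?_ h.output
      · rw [hoos]
        have := s.parity_lt_two
        omega
      · rw [hoos]
        have := s.parity_lt_two
        omega
      · rw [Function.update_self, List.reverse_cons, hsent]
        simpa using h.matching_sender.append (s₂ := [C (st.party s).sent]) (r₂ := [])
          (by simp [IsMatching])
      · rw [Function.update_of_ne hne, Function.update_self, List.reverse_cons]
        simpa using h.matching_other.append (s₂ := []) (r₂ := [σ]) (by simp [IsMatching])
      · rw [Function.update_of_ne hne, Function.update_self]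
      · have := h.bad_le s.other
        rw [hoo] at this
        rw [Function.update_self]
        exact this.trans (badCount_le_cons _ _ _)
      · refine ⟨hpart ?_ ?_, hpart ?_ ?_, ?_⟩
        · have := h.accounting.inserted s
          simp [blanks₁_cons, Function.update_of_ne hne]; omega
        · have := h.accounting.inserted s.other
          rw [hoo] at this
          simp [blanks₁_cons, Function.update_of_ne hne, hoo]; omega
        · have := h.accounting.deleted s
          simp [blanks₂_cons]; omega
        · have := h.accounting.deleted s.other
          rw [hoo] at this
          simp [blanks₂_cons, Function.update_of_ne hne, hoo]; omega
        · rw [hoos]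
          simp only [Event.isCorruption, if_true]; omega
      · rw [Function.update_self]
        have := h.settled_sender
        unfold Settled Waiting at *
        omega
      · rw [Function.update_of_ne hne]
        exact Or.inl h.settled_other
    · right
      refine finished_receive hN (hall _ hN ?_) h.output
      cases s <;> simp [Party.other, Party.parity, Event.isCorruption] at * <;> omega

theorem exists_invariant_initial {ε β B : ℝ} {R : ℕ} (hpar : Parameters T N R ε β B) (hT : 1 ≤ T)
    (hN : 1 ≤ N) (hB : 0 ≤ B)
    (hv : IsCorrectLeaf T X v) (hX : ∀ p, IsInput T p (X p))
    (hC : IsEditTreeCode (1 - ε) N C) (ch : Party → Choices T N C) :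
    ∃ s M r bad idle sub oos,
      Invariant C T X v β R 0 0 (initial ch R X) s M r bad idle sub oos := by
  -- Alice's first round counts as a correct decoding of the empty word, by the empty matching. She
  -- announces her edge on level 1 and so reaches depth 2; the round is idle unless `T = 1`.
  have hdec : (ch .alice).dec [] = [] :=
    (ch .alice).dec_eq hpar.pos hpar.le hpar.lt hC (τ := []) (by simp [encode_eq_pathWord, pathWord, isMatching_nil])
      (fun σ h0 hσ => absurd (List.suffix_nil.1 hσ) h0) (by simp)
  have h0 := healthy_empty (T := T) (N := N) (X := X) (v := v) (Γ := Γ)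
  obtain ⟨r', h1, h2, h3⟩ := (h0 .alice).round_of_eq hv hX (h0 .bob).toAnnouncing (ch .alice) R
    (by simpa using Nat.pos_of_ne_zero (by omega)) hdec
  obtain rfl : r' = 2 := h2 (by decide) hT
  have hR : 2 * 0 + (if 1 < T then 1 else 0) < R := by
    refine hpar.votes 0 0 0 _ (by simpa using hB) ?_
    split_ifs <;> omega
  have hR0 : 0 < R := by omega
  set st' := round (ch .alice) R .alice (X .alice) ({} : PartyState N Γ) with hst'
  have hrounds : st'.rounds = 1 := by simp [hst', round, PartyState.rounds]
  refine ⟨.alice, fun _ => [], fun p => p.casesOn 2 1, fun _ => 0,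
    fun p => p.casesOn (if 1 < T then 1 else 0) 0, fun _ => 0, fun _ => 0, rfl, ?_, ?_, ?_, ?_, ?_,
    ?_, ?_, ?_, ?_, ?_, ?_, ?_, ?_⟩
  · rintro (_ | _)
    · simp [initial, ← hst', hrounds]; omega
    · simp [initial, PartyState.rounds]
  · simp [initial, ← hst', hrounds]; simp [PartyState.rounds]
  · simp [initial, ← hst', hrounds, Party.parity]
  · simp [initial, ← hst', hrounds, Party.parity]; simp [PartyState.rounds]
  · rintro (_ | _)
    · simp only [initial, Function.update_self]
      exact h3
    · exact h0 .bob
  · simp [initial, round]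
  · simp [initial, round, IsMatching, Party.other, encode_eq_pathWord, pathWord]
  · simp [initial, round, IsMatching, Party.other, encode_eq_pathWord, pathWord]
  · simp
  · exact ⟨by simp, by simp, by simp⟩
  · unfold Settled Waiting
    simp only [Party.other]
    split_ifs <;> omega
  · simp [Settled, Party.other]
  · rintro (_ | _)
    · simp only [initial, Function.update_self]
      exact h3.output_round hv.1 hR fun h => by simp [PartyState.rounds] at h; omega
    · intro h
      simp [initial, PartyState.rounds] at h
      omega

theorem invariant_or_finished {ε β B : ℝ} {R : ℕ} (hpar : Parameters T N R ε β B) (hT : 1 ≤ T)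
    (hN : 1 ≤ N) (hv : IsCorrectLeaf T X v) (hX : ∀ p, IsInput T p (X p))
    (hC : IsEditTreeCode (1 - ε) N C) (ch : Party → Choices T N C) (events : List (Event Γ))
    (hB : (corruptions events : ℝ) ≤ B) :
    (∃ s M r bad idle sub oos, Invariant C T X v β R (corruptions events) events.length
      (run ch R X events) s M r bad idle sub oos) ∨ Finished R v (run ch R X events) := by
  induction events using List.reverseRecOn with
  | nil => exact Or.inl (exists_invariant_initial hpar hT hN (by simpa [corruptions] using hB) hv hX
      hC ch)
  | append_singleton events ev ih =>
    have hc : corruptions (events ++ [ev]) =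
        corruptions events + if ev.isCorruption then 1 else 0 := by
      simp [corruptions, List.countP_append, List.countP_cons]
    have hrun : run ch R X (events ++ [ev]) = step ch R X (run ch R X events) ev := by
      simp [run]
    rw [hc] at hB ⊢
    rw [hrun, List.length_append, List.length_singleton]
    rcases ih (le_trans (by push_cast; split_ifs <;> simp) hB) with
      ⟨s, M, r, bad, idle, sub, oos, h⟩ | h
    · exact h.exists_step hpar hv hX hC ch ev hB
    · right
      have : step ch R X (run ch R X events) ev = run ch R X events := by
        simp only [step, h.sender]
      rwa [this]

end Execution

/-! ### The parameters -/

theorem parameters {ε ρ : ℝ} {T N R : ℕ} (hε : 0 < ε) (hε' : ε ≤ 1 / 18) (hT : 1 ≤ T)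
    (hN : N = ⌈(T : ℝ) / (16 * ε)⌉₊) (hρ : ρ = 1 / 18 - ε) (hR : R = ⌊(1 - 2 * ρ) * (N : ℝ)⌋₊) :
    Parameters T N R ε (1 - 9 / 4 * ε) (2 * ρ * N) := by
  have hNT : (T : ℝ) ≤ 16 * ε * N := by
    have := Nat.le_ceil ((T : ℝ) / (16 * ε))
    rw [← hN, div_le_iff₀ (by positivity)] at this
    linarith
  have hN0 : (0 : ℝ) ≤ N := by positivity
  refine ⟨hε, hε', by linarith, by linarith, fun b b' o u hb hu => ?_, fun k hk => ?_⟩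
  · have hlt := Nat.lt_floor_add_one ((1 - 2 * ρ) * (N : ℝ))
    rw [← hR] at hlt
    -- Division by `β = 1 - 9 / 4 * ε` costs at most `2 * ε * N`, because `36 * ρ = 2 - 36 * ε`.
    have hS : (2 * b + b' + o : ℝ) ≤ 16 * ρ * N + 2 * ε * N := by
      have hβ : 0 < 1 - 9 / 4 * ε := by linarith
      refine le_of_mul_le_mul_left (hb.trans ?_) hβ
      have : 0 ≤ ε * ε * N := by positivity
      subst hρ
      nlinarith
    -- With `T ≤ 16 * ε * N` the sum is at most `16 * (ρ + ε) * N + 2 * ε * N = (8 / 9 + 2 * ε) *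
    -- N`, which is exactly `(1 - 2 * ρ) * N`. Since idle rounds cost only `T / 2` and `T ≥ 1`, the
    -- strict inequality follows.
    have h1 : (2 * b + b' + o + T : ℝ) < R + 1 := by
      subst hρ
      nlinarith
    have h2 : 2 * b + b' + o + T < R + 1 := by exact_mod_cast h1
    omega
  · have hle : (R : ℝ) ≤ (1 - 2 * ρ) * (N : ℝ) := by
      rw [hR]
      refine Nat.floor_le (mul_nonneg ?_ hN0)
      linarith
    have : (R + k : ℝ) ≤ N := by linarith
    exact_mod_cast this

theorem exists_editTreeCode_polynomial {ε : ℝ} (hε : 0 < ε) : ∃ c k : ℕ, ∀ T N : ℕ, 1 ≤ T →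
    N = ⌈(T : ℝ) / (16 * ε)⌉₊ → ∃ q : ℕ, q ≤ c * T ^ k ∧ ∃ C : PrefixCode (Sym N) (Fin q),
      IsEditTreeCode (1 - ε) N C := by
  set a := ⌈1 / (16 * ε)⌉₊ with ha
  refine ⟨(a + 1) * (32 * (4 * (a + 1)) ^ 4), 5, fun T N hT hN => ?_⟩
  obtain ⟨q, hq, C, hC⟩ := exists_isEditTreeCode (S := Sym N) N
  refine ⟨q, hq.trans ?_, C, hC _ (by linarith)⟩
  have hNa : N ≤ a * T := by
    rw [hN]
    refine Nat.ceil_le.2 ?_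
    push_cast
    have := Nat.le_ceil (1 / (16 * ε))
    calc (T : ℝ) / (16 * ε) = 1 / (16 * ε) * T := by ring
      _ ≤ a * T := mul_le_mul_of_nonneg_right this (by positivity)
  have hN1 : N + 1 ≤ (a + 1) * T := by nlinarith
  have hcard : Fintype.card (Sym N) = 4 * (N + 1) := by
    simp [Sym]; ring
  rw [hcard]
  calc (N + 1) * (32 * (4 * (N + 1)) ^ 4)
      ≤ ((a + 1) * T) * (32 * (4 * ((a + 1) * T)) ^ 4) := by gcongr
    _ = (a + 1) * (32 * (4 * (a + 1)) ^ 4) * T ^ 5 := by ring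

end EditPJP

theorem mainTheorem3 (ε : ℝ) (hε : 0 < ε) (hε' : ε ≤ 1 / 18) :
    ∃ c k : ℕ, ∀ T : ℕ, 1 ≤ T → ∀ (N R : ℕ) (ρ : ℝ),
      N = ⌈(T : ℝ) / (16 * ε)⌉₊ → ρ = 1 / 18 - ε → R = ⌊(1 - 2 * ρ) * (N : ℝ)⌋₊ →
      (∃ q : ℕ, q ≤ c * T ^ k ∧ ∃ C : EditPJP.PrefixCode (EditPJP.Sym N) (Fin q),
        EditPJP.IsEditTreeCode (1 - ε) N C) ∧
      ∀ (Γ : Type) (C : EditPJP.PrefixCode (EditPJP.Sym N) Γ),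
        EditPJP.IsEditTreeCode (1 - ε) N C →
        ∀ (ch : EditPJP.Party → EditPJP.Choices T N C) (X : EditPJP.Party → Set EditPJP.Edge),
          (∀ p, EditPJP.IsInput T p (X p)) →
          ∀ events : List (EditPJP.Event Γ),
            (EditPJP.corruptions events : ℝ) ≤ 2 * ρ * (N : ℝ) →
            (2 * N ≤ events.length → (EditPJP.run ch R X events).sender = none) ∧
            ((EditPJP.run ch R X events).sender = none →
              ∀ p, R ≤ ((EditPJP.run ch R X events).party p).rounds) ∧
            ∀ p, R ≤ ((EditPJP.run ch R X events).party p).rounds →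
              ∃ v, EditPJP.IsCorrectLeaf T X v ∧
                ((EditPJP.run ch R X events).party p).output = some v := by
  obtain ⟨c, k, hck⟩ := EditPJP.exists_editTreeCode_polynomial hε
  refine ⟨c, k, fun T hT N R ρ hN hρ hR => ⟨hck T N hT hN, fun Γ C hC ch X hX events hB => ?_⟩⟩
  have hpar := EditPJP.parameters hε hε' hT hN hρ hR
  have hN1 : 1 ≤ N := by
    rw [hN, Nat.one_le_ceil_iff]
    have : (0 : ℝ) < T := by exact_mod_cast hT
    positivity
  obtain ⟨v, hv⟩ := EditPJP.exists_isCorrectLeaf hX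
  rcases EditPJP.invariant_or_finished hpar hT hN1 hv hX hC ch events hB with
    ⟨s, M, r, bad, idle, sub, oos, h⟩ | h
  · refine ⟨fun hlen => ?_, fun hs => ?_, fun p hp => ⟨v, hv, h.output p hp⟩⟩
    · have h1 := h.rounds_add
      have h2 := h.rounds_le .alice
      have h3 := h.rounds_le .bob
      omega
    · rw [h.sender] at hs
      exact absurd hs (by simp)
  · exact ⟨fun _ => h.sender, fun _ => h.rounds, fun p _ => ⟨v, hv, h.output p⟩⟩
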